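/- Conventions. Predicates are subsets of $\omega^n$ ($n>0$) and function symbols are total functions $\omega^n\to\omega$ ($n\ge 0$), each taken together with its arity and interpreted as itself over $\omega$. A structure is a set $\mathcal M$ of predicates and function symbols containing $\{=,<,S,+,\cdot\}$ with their usual interpretation; it is $L$-finite if this set is finite. $\mathcal D(\mathcal M)$ is the set of all $X\subseteq\omega$ that are first-order definable in $\mathcal M$, and $\mathcal M\sim\mathcal M'$ means $\mathcal D(\mathcal M)=\mathcal D(\mathcal M')$. For $G\subseteq\omega^2$ let $G(n,\cdot)=\{m: G(n,m)\}$. $G$ is a universal predicate for $\mathcal M$ if $\mathcal D(\mathcal M)\subseteq\{G(n,\cdot):n\in\omega\}$, and a proper universal predicate for $\mathcal M$ if $\mathcal D(\mathcal M)=\{G(n,\cdot):n\in\omega\}$. A (proper) universal predicate $P_0$ for $\mathcal M$ is canonic if $P_0$ is definable in $\mathcal M\cup\{P\}$ for every (proper) universal predicate $P$ for $\mathcal M$. A Tarski hierarchy over a structure $\mathcal N$ is a sequence of structures $\{\mathcal M_\alpha\}_{\alpha\le\lambda(\mathcal N)}$ such that (1) $\mathcal M_0=\mathcal N$; (2) for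 every $\alpha<\lambda(\mathcal N)$, $\mathcal M_{\alpha+1}=\mathcal M_\alpha\cup\{P_\alpha\}$ for some canonic universal predicate $P_\alpha$ for $\mathcal M_\alpha$; (3) $\mathcal M_\beta=\bigcup_{\alpha<\beta}\mathcal M_\alpha$ for every limit ordinal $\beta\le\lambda(\mathcal N)$; (4) $\lambda(\mathcal N)$ is the maximum ordinal for which there is a sequence satisfying (1)-(3). A proper Tarski hierarchy $\{\mathcal M^p_\alpha\}_{\alpha\le\lambda^p(\mathcal N)}$ over $\mathcal N$ is defined in the same way with "canonic proper universal predicate" in place of "canonic universal predicate". Theorem. Let $\{\mathcal M_\alpha\}_{\alpha\le\lambda(\mathcal N)}$ be a Tarski hierarchy over an $L$-finite structure $\mathcal N$ and let $\{\mathcal M^p_\alpha\}_{\alpha\le\lambda^p(\mathcal N)}$ be a proper Tarski hierarchy over $\mathcal N$. Then $\lambda^p(\mathcal N)>\lambda(\mathcal N)$, and $\mathcal M^p_\alpha\sim\mathcal M_\alpha$ for every $\alpha\le\lambda(\mathcal N)$. Hence the structure $\mathcal M_{\lambda(\mathcal N)}$ does not have a canonic universal predicate but does have a canonic proper universal predicate.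 -/

import Mathlib

namespace TarskiHierarchy

/-- The predicates and function symbols, interpreted in themselves over the natural numbers:
`pred n hn A` is the `n`-ary predicate with extension `A` (`n > 0`), and `func n f` is the `n`-ary
function symbol with extension `f` (`n ≥ 0`). -/
inductive Symb : Type
  | pred (n : ℕ) (hn : 0 < n) (A : Set (Fin n → ℕ)) : Symb
  | func (n : ℕ) (f : (Fin n → ℕ) → ℕ) : Symb

/-- The binary predicate with extension `A`. -/
def Symb.pred₂ (A : Set (Fin 2 → ℕ)) : Symb := Symb.pred 2 two_pos A

/-- The arithmetic `{=, <, S, +, ·}`, interpreted in the usual way. -/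
def arith : Set Symb :=
  {Symb.pred₂ {v | v 0 = v 1}, Symb.pred₂ {v | v 0 < v 1},
    Symb.func 1 (fun v => v 0 + 1), Symb.func 2 (fun v => v 0 + v 1),
    Symb.func 2 (fun v => v 0 * v 1)}

/-- A structure: a set of predicates and function symbols that contains the arithmetic. -/
@[ext]
structure Struct where
  /-- The symbols of the structure. -/
  symbols : Set Symb
  /-- The structure contains the arithmetic. -/
  arith_subset : arith ⊆ symbols

namespace Struct

/-- A structure is `L`-finite if it consists of finitely many predicates and function symbols. -/
def LFinite (M : Struct) : Prop := M.symbols.Finite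

/-- The structure `M + P`, obtained by adding the binary predicate `P` to `M`. -/
def add (M : Struct) (P : Set (Fin 2 → ℕ)) : Struct where
  symbols := M.symbols ∪ {Symb.pred₂ P}
  arith_subset := M.arith_subset.trans Set.subset_union_left

/-- The first-order language whose symbols are the elements of `M`. -/
def lang (M : Struct) : FirstOrder.Language.{0, 0} where
  Functions n := {f : (Fin n → ℕ) → ℕ // Symb.func n f ∈ M.symbols}
  Relations n := {A : Set (Fin n → ℕ) // ∃ hn : 0 < n, Symb.pred n hn A ∈ M.symbols}

/-- Every symbol is interpreted as itself. -/
instance interp (M : Struct) : M.lang.Structure ℕ where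
  funMap f v := f.1 v
  RelMap A v := v ∈ A.1

/-- `X ⊆ ω^k` is (first-order, without parameters) definable in `M`. -/
def Defines (M : Struct) {k : ℕ} (X : Set (Fin k → ℕ)) : Prop :=
  (∅ : Set ℕ).Definable M.lang X

/-- The family `D(M)` of all subsets of `ω` definable in `M`. -/
def D (M : Struct) : Set (Set ℕ) := {X | M.Defines {v : Fin 1 → ℕ | v 0 ∈ X}}

/-- `M ∼ N` if `D(M) = D(N)`. -/
def Equivalent (M N : Struct) : Prop := M.D = N.D

end Struct

/-- The section `G(n, ·) = {m : G(n, m)}`. -/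
def sect (G : Set (Fin 2 → ℕ)) (n : ℕ) : Set ℕ := {m | ![n, m] ∈ G}

/-- `G` is a universal predicate for `M`: every member of `D(M)` is a section of `G`. -/
def IsUniversal (M : Struct) (G : Set (Fin 2 → ℕ)) : Prop := M.D ⊆ Set.range (sect G)

/-- `P` is a proper universal predicate for `M`: the sections of `P` are exactly the members
of `D(M)`. -/
def IsProperUniversal (M : Struct) (P : Set (Fin 2 → ℕ)) : Prop := M.D = Set.range (sect P)

/-- `P₀` is a minimum, in terms of definability over `M`, among the binary predicates that are
related to `M` by `U`. -/
def IsCanonic (U : Struct → Set (Fin 2 → ℕ) → Prop) (M : Struct) (P₀ : Set (Fin 2 → ℕ)) : Prop :=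
  U M P₀ ∧ ∀ P, U M P → (M.add P).Defines P₀

/-- `P₀` is a canonic universal predicate for `M`. -/
def IsCanonicUniversal (M : Struct) (P₀ : Set (Fin 2 → ℕ)) : Prop :=
  IsCanonic IsUniversal M P₀

/-- `P₀` is a canonic proper universal predicate for `M`. -/
def IsCanonicProperUniversal (M : Struct) (P₀ : Set (Fin 2 → ℕ)) : Prop :=
  IsCanonic IsProperUniversal M P₀

/-- The values at the ordinals `α ≤ ξ` of `M` form a sequence that starts with `N`, adds at each
successor step a binary predicate that stands in the relation `C` to the structure reached so far,
and takes unions at limits. (The values of `M` above `ξ` are irrelevant.) -/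
structure IsSequence (C : Struct → Set (Fin 2 → ℕ) → Prop) (N : Struct) (ξ : Ordinal.{0})
    (M : Ordinal.{0} → Struct) : Prop where
  zero : M 0 = N
  succ : ∀ α < ξ, ∃ P, C (M α) P ∧ M (Order.succ α) = (M α).add P
  limit : ∀ β ≤ ξ, Order.IsSuccLimit β → (M β).symbols = ⋃ α < β, (M α).symbols

/-- Such a sequence whose length `ξ` is the maximum of the lengths of all such sequences. -/
def IsMaximalSequence (C : Struct → Set (Fin 2 → ℕ) → Prop) (N : Struct) (ξ : Ordinal.{0})
    (M : Ordinal.{0} → Struct) : Prop :=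
  IsSequence C N ξ M ∧ IsGreatest {η : Ordinal.{0} | ∃ M', IsSequence C N η M'} ξ

/-- `{M α}_{α ≤ ξ}` is a Tarski hierarchy over `N`, and `ξ = λ(N)`. -/
def IsTarskiHierarchy (N : Struct) (ξ : Ordinal.{0}) (M : Ordinal.{0} → Struct) : Prop :=
  IsMaximalSequence IsCanonicUniversal N ξ M

/-- `{M α}_{α ≤ ξ}` is a proper Tarski hierarchy over `N`, and `ξ = λᵖ(N)`. -/
def IsProperTarskiHierarchy (N : Struct) (ξ : Ordinal.{0}) (M : Ordinal.{0} → Struct) : Prop :=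
  IsMaximalSequence IsCanonicProperUniversal N ξ M

end TarskiHierarchy

/-!
The statement is about definability in structures, but only the families of definable sets matter.
Gödel's coding of finite sequences makes primitive recursive functions definable, so that `D(K)` is
closed under joins and under arithmetical definability (`RedTo A B`: the set `A` is arithmetical in
`B`). Conversely, induction on formulas shows that `D(K)` is the least such *ideal* containing the
codes of the symbols of `K` (`D_subset_of_codes`). A universal predicate becomes a set `P` of which
every member of the ideal is a row (`Covers`), a proper one a set whose rows are exactly the members
(`Enumerates`), and "canonic" means being arithmetical in all sets of the same kind. In particular,
adding a universal predicate `P` to `K` gives the ideal `below P` of the sets arithmetical in `P`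
(`D_add_eq_below`), and a Tarski hierarchy over an `L`-finite structure becomes an `IsTower`: it
starts with `below B` for some `B`, adds least covers at successors, and takes unions at limits.

The main result is `IsTower.exists_least_enumeration`: each ideal `D α` of a tower has a least
enumeration, and below the top of the tower this enumeration is arithmetical even in every cover of
`D α`, thus equivalent to the least cover. Hence both hierarchies have the same definable sets as
long as both exist (`IsSequence.D_eq`), and the proper one can always be continued at the ordinal
where the other one stops, while a maximal sequence cannot be continued
(`IsMaximalSequence.not_exists`).

For `α = 0` and for successors, `D α = below C` for some `C`, and the truth set of arithmetic with
oracle `C` is both an enumeration and a least cover: from a cover one recovers its levels by the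
uniqueness of solutions of the recursion that defines truth (`redTo_solution_of_covers`,
`truth_redTo`). For limits, truth sets are iterated along relations. The set `hier R B` collects the
truth sets along a transitive relation `R` that is arithmetical in `B`. At a node of rank `α`, its
rows contain `D α`, and its part up to this node belongs to `D (α + 1)` (`IsTower.arithAt_of_mem`,
`IsTower.hier_mem`). Therefore, if the limit `α` is *coded*, i.e. is the rank of a point of such a
relation, the rows below this point form an enumeration of `D α` that is arithmetical in every cover
(`IsTower.exists_enumerates_of_isCoded`).

Let `κ` be the first ordinal that is not coded. Two facts remain.

* The tower does not extend beyond `κ` (`IsTower.not_lt_of_not_isCoded`): `D κ` has no least cover.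
  Call `G` rich if it has, for each `R` as above and each node, a row that is the hierarchy up to
  this node or that shows that the node is not accessible. Richness is an arithmetical property, so
  the rich sets, with Skolem functions for the truth of this property, are the branches of a tree
  that is arithmetical in `B`. Every rich set covers `D κ` up to arithmetical equivalence, so a
  least cover `P κ` would be arithmetical in each of them. By Baire category, a fixed bit of the
  branches decides `P κ` near some branch (`exists_uniform_rule`). Then the tree of the pairs of
  nodes with different answers is well-founded, its rank is coded and so less than `κ`, and a
  recursion along it computes `P κ` inside `D κ` (`IsTower.mem_of_branches`). This contradicts
  Cantor's diagonal argument.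
* At `κ`, the rows of all hierarchies along well-founded relations, with their indices, enumerate
  `D κ`, and this enumeration is arithmetical in every other enumeration
  (`IsTower.exists_enumerates_of_not_isCoded`). The rows of an enumeration are exactly the members
  of `D κ`, so it suffices to recognize well-foundedness by quantification over `D κ`. A point is
  accessible if and only if `D κ` contains a solution of the recursion up to this point and no
  nonempty set without minimal elements that contains this point (`IsTower.acc_of_isApprox`). A
  cover may have other rows, which is where the argument fails for universal predicates.
-/

namespace TarskiHierarchy

open Nat (pair unpair)
open Encodable

/-! ### Recursion along a relation with oracle sets -/

/-- The row `{x : ⟨p, x⟩ ∈ X}` of a set of (codes of) pairs. -/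
def row (X : Set ℕ) (p : ℕ) : Set ℕ := {x | pair p x ∈ X}

@[simp] theorem mem_row {X : Set ℕ} {p x : ℕ} : x ∈ row X p ↔ pair p x ∈ X := Iff.rfl

/-- The value of `Φ X p` depends only on the rows of `X` below `p`. -/
def IsLocal (r : ℕ → ℕ → Prop) (Φ : Set ℕ → ℕ → ℕ → Prop) : Prop :=
  ∀ X Y p x, (∀ q, r q p → row X q = row Y q) → (Φ X p x ↔ Φ Y p x)

theorem wellFounded_and_acc (r : ℕ → ℕ → Prop) : WellFounded fun q p => r q p ∧ Acc r p := by
  have h : ∀ p, Acc r p → Acc (fun q p => r q p ∧ Acc r p) p := fun p hp => by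
    induction hp with
    | intro p _ ih => exact ⟨p, fun q hq => ih q hq.1⟩
  exact ⟨fun p => ⟨p, fun q hq => h q (hq.2.inv hq.1)⟩⟩

/-- The set `X` of pairs whose rows are given by `row X p = Φ X p`, by recursion along `r`. The
recursion refers to rows below `p` only if `p` is accessible, so that it is always well-founded;
the recursion equation holds at the accessible points. -/
def solution (r : ℕ → ℕ → Prop) (Φ : Set ℕ → ℕ → ℕ → Prop) : Set ℕ :=
  {t | (wellFounded_and_acc r).fix (C := fun _ => ℕ → Prop)
    (fun p ih x => Φ {s | ∃ h : r s.unpair.1 p ∧ Acc r p, ih s.unpair.1 h s.unpair.2} p x)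
    t.unpair.1 t.unpair.2}

variable {r : ℕ → ℕ → Prop} {Φ : Set ℕ → ℕ → ℕ → Prop}

theorem mem_solution (hΦ : IsLocal r Φ) {p : ℕ} (hp : Acc r p) (x : ℕ) :
    pair p x ∈ solution r Φ ↔ Φ (solution r Φ) p x := by
  have h : pair p x ∈ solution r Φ ↔
      Φ {s | ∃ _ : r s.unpair.1 p ∧ Acc r p, s ∈ solution r Φ} p x := by
    conv_lhs => rw [solution, Set.mem_ofPred_eq, WellFounded.fix_eq]
    simp only [Nat.unpair_pair]
    rfl
  rw [h]
  refine hΦ _ _ _ _ fun q hq => ?_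
  ext x
  simp [hq, hp]

/-- `X` satisfies the recursion equation at `p` and at all points below `p`. -/
def IsApprox (r : ℕ → ℕ → Prop) (Φ : Set ℕ → ℕ → ℕ → Prop) (p : ℕ) (X : Set ℕ) : Prop :=
  ∀ q, (q = p ∨ r q p) → ∀ x, pair q x ∈ X ↔ Φ X q x

/-- At accessible points, the recursion equation has only one solution. -/
theorem IsApprox.row_eq (hΦ : IsLocal r Φ) (hr : ∀ a b c, r a b → r b c → r a c) {p : ℕ}
    {X : Set ℕ} (hX : IsApprox r Φ p X) {q : ℕ} (hq : Acc r q) (hqp : q = p ∨ r q p) :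
    row X q = row (solution r Φ) q := by
  induction hq with
  | intro q hq ih =>
    have hq' : Acc r q := ⟨q, hq⟩
    ext x
    rw [mem_row, mem_row, hX q hqp, mem_solution hΦ hq']
    refine hΦ _ _ _ _ fun s hs => ih s hs (.inr ?_)
    rcases hqp with rfl | h
    exacts [hs, hr _ _ _ hs h]

theorem isApprox_solution (hΦ : IsLocal r Φ) {p : ℕ} (hp : Acc r p) :
    IsApprox r Φ p (solution r Φ) := by
  rintro q (rfl | h) x
  exacts [mem_solution hΦ hp x, mem_solution hΦ (hp.inv h) x]

/-- The part of the solution that consists of the rows up to `p`. -/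
def solutionUpTo (r : ℕ → ℕ → Prop) (Φ : Set ℕ → ℕ → ℕ → Prop) (p : ℕ) : Set ℕ :=
  {t | (t.unpair.1 = p ∨ r t.unpair.1 p) ∧ t ∈ solution r Φ}

theorem row_solutionUpTo {p q : ℕ} (h : q = p ∨ r q p) :
    row (solutionUpTo r Φ p) q = row (solution r Φ) q := by
  ext x; simp [solutionUpTo, h]

theorem isApprox_solutionUpTo (hΦ : IsLocal r Φ) (hr : ∀ a b c, r a b → r b c → r a c) {p : ℕ}
    (hp : Acc r p) : IsApprox r Φ p (solutionUpTo r Φ p) := by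
  intro q hq x
  rw [← mem_row, row_solutionUpTo hq, mem_row, isApprox_solution hΦ hp q hq]
  refine hΦ _ _ _ _ fun s hs => (row_solutionUpTo (.inr ?_)).symm
  rcases hq with rfl | h
  exacts [hs, hr _ _ _ hs h]

/-! ### The hierarchy of truth sets along a relation -/

/-- The lexicographic order of pairs `⟨v, n⟩`, by `R` and then by the order of `ℕ`. -/
def lex (R : ℕ → ℕ → Prop) (q p : ℕ) : Prop :=
  R q.unpair.1 p.unpair.1 ∨ q.unpair.1 = p.unpair.1 ∧ q.unpair.2 < p.unpair.2

theorem lex_trans {R : ℕ → ℕ → Prop} (hR : ∀ a b c, R a b → R b c → R a c) (a b c : ℕ)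
    (hab : lex R a b) (hbc : lex R b c) : lex R a c := by
  rcases hab with h | ⟨h, h'⟩ <;> rcases hbc with k | ⟨k, k'⟩
  · exact .inl (hR _ _ _ h k)
  · exact .inl (k ▸ h)
  · exact .inl (h ▸ k)
  · exact .inr ⟨h.trans k, h'.trans k'⟩

theorem acc_lex {R : ℕ → ℕ → Prop} {p : ℕ} (h : Acc R p.unpair.1) : Acc (lex R) p := by
  generalize hv : p.unpair.1 = v at h
  induction h generalizing p with
  | intro v _ ih =>
    generalize hn : p.unpair.2 = n
    induction n using Nat.strong_induction_on generalizing p with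
    | _ n ihn =>
      refine ⟨p, ?_⟩
      rintro q (h | ⟨h, h'⟩)
      · exact ih _ (hv ▸ h) rfl
      · exact ihn _ (hn ▸ h') (h.trans hv) rfl

/-- The `w`-th attempt of the `e`-th partial recursive procedure to produce a question about `x`:
`w` codes a bound for the running time and an auxiliary argument. -/
def ask (e x w : ℕ) : Option ℕ :=
  Nat.Partrec.Code.evaln w.unpair.1 (Denumerable.ofNat Nat.Partrec.Code e) (pair x w.unpair.2)

/-- One step of the hierarchy along `R` with oracle `B`. At a position `p = ⟨v, n⟩` with `n = 0` the
row is the oracle. Otherwise `x` belongs to the row if the procedure coded by the first component of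
`n` produces, for some auxiliary argument, a pair `⟨q, z⟩` such that `q` precedes `p` and `z` is not
in row `q`. The second component of `n` allows for arbitrarily large `n` with the same procedure. -/
def step (R : ℕ → ℕ → Prop) (B X : Set ℕ) (p x : ℕ) : Prop :=
  (p.unpair.2 = 0 ∧ x ∈ B) ∨ (p.unpair.2 ≠ 0 ∧
    ∃ w s, ask p.unpair.2.unpair.1 x w = some s ∧ lex R s.unpair.1 p ∧ s ∉ X)

theorem isLocal_step (R : ℕ → ℕ → Prop) (B : Set ℕ) : IsLocal (lex R) (step R B) := by
  intro X Y p x h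
  have : ∀ s : ℕ, lex R s.unpair.1 p → (s ∈ X ↔ s ∈ Y) := fun s hs => by
    have := Set.ext_iff.1 (h _ hs) s.unpair.2
    simpa using this
  unfold step
  refine or_congr_right (and_congr_right fun _ => exists_congr fun w => exists_congr fun s =>
    and_congr_right fun _ => and_congr_right fun hs => not_congr (this s hs))

/-- The hierarchy of truth sets along `R` with oracle `B`: for accessible `v`, the rows `⟨v, n⟩` are
the sets that are arithmetical in `B` together with all rows `⟨u, m⟩` where `R u v`. -/
def hier (R : ℕ → ℕ → Prop) (B : Set ℕ) : Set ℕ := solution (lex R) (step R B)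

theorem mem_hier {R : ℕ → ℕ → Prop} {B : Set ℕ} {p : ℕ} (hp : Acc R p.unpair.1) (x : ℕ) :
    pair p x ∈ hier R B ↔ step R B (hier R B) p x :=
  mem_solution (isLocal_step R B) (acc_lex hp) x

/-! ### Primitive recursive functions -/

section Primrec

variable {α β γ : Type*} [Primcodable α] [Primcodable β] [Primcodable γ]

attribute [fun_prop] Primrec

@[fun_prop] theorem primrec_id : Primrec fun a : α => a := Primrec.id

@[fun_prop] theorem primrec_const (c : β) : Primrec fun _ : α => c := Primrec.const c

@[fun_prop] theorem primrec_comp {f : β → γ} {g : α → β} (hf : Primrec f) (hg : Primrec g) :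
    Primrec fun a => f (g a) := hf.comp hg

@[fun_prop] theorem primrec_fst {f : α → β × γ} (hf : Primrec f) : Primrec fun a => (f a).1 :=
  Primrec.fst.comp hf

@[fun_prop] theorem primrec_snd {f : α → β × γ} (hf : Primrec f) : Primrec fun a => (f a).2 :=
  Primrec.snd.comp hf

@[fun_prop] theorem primrec_mk {f : α → β} {g : α → γ} (hf : Primrec f) (hg : Primrec g) :
    Primrec fun a => (f a, g a) := hf.pair hg

@[fun_prop] theorem primrec_pair {f g : α → ℕ} (hf : Primrec f) (hg : Primrec g) :
    Primrec fun a => pair (f a) (g a) := Primrec₂.natPair.comp hf hg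

@[fun_prop] theorem primrec_unpair {f : α → ℕ} (hf : Primrec f) :
    Primrec fun a => unpair (f a) := Primrec.unpair.comp hf

@[fun_prop] theorem primrec_add {f g : α → ℕ} (hf : Primrec f) (hg : Primrec g) :
    Primrec fun a => f a + g a := Primrec.nat_add.comp hf hg

@[fun_prop] theorem primrec_some {f : α → β} (hf : Primrec f) :
    Primrec fun a => some (f a) := Primrec.option_some.comp hf

@[fun_prop] theorem primrec_encode {f : α → β} (hf : Primrec f) :
    Primrec fun a => encode (f a) := Primrec.encode.comp hf

@[fun_prop] theorem primrec_decode {f : α → ℕ} (hf : Primrec f) :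
    Primrec fun a => (decode (f a) : Option β) := Primrec.decode.comp hf

@[fun_prop] theorem primrec_length {f : α → List β} (hf : Primrec f) :
    Primrec fun a => (f a).length := Primrec.list_length.comp hf

@[fun_prop] theorem primrec_take {f : α → ℕ} {g : α → List β} (hf : Primrec f) (hg : Primrec g) :
    Primrec fun a => (g a).take (f a) := Primrec.list_take.comp hf hg

@[fun_prop] theorem primrec_getD {f : α → ℕ} {g : α → List β} {d : β} (hf : Primrec f)
    (hg : Primrec g) : Primrec fun a => (g a).getD (f a) d := (Primrec.list_getD d).comp hg hf

@[fun_prop] theorem primrec_ask {e x w : α → ℕ} (he : Primrec e) (hx : Primrec x)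
    (hw : Primrec w) : Primrec fun a => ask (e a) (x a) (w a) :=
  Nat.Partrec.Code.primrec_evaln.comp
    (((primrec_fst (primrec_unpair hw)).pair ((Primrec.ofNat _).comp he)).pair
      (primrec_pair hx (primrec_snd (primrec_unpair hw))))

end Primrec

/-! ### Arithmetical definability relative to oracles -/

section Arith

variable {ι α β : Type} [Primcodable α] [Primcodable β]

/-- The predicate `Ψ i`, uniformly in `i`, is the predicate of some row `⟨v, n⟩` of the hierarchy
along `R` with oracle `O i`. -/
def ArithAt (R : ℕ → ℕ → Prop) (v : ℕ) (O : ι → Set ℕ) (Ψ : ι → α → Prop) : Prop :=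
  ∃ n, ∀ i a, Ψ i a ↔ pair (pair v n) (encode a) ∈ hier R (O i)

/-- The predicate `Ψ i` is arithmetical in `O i`, by a definition that does not depend on `i`.
The hierarchy along the empty relation serves as the truth definition for arithmetic with an
oracle. -/
def Arith (O : ι → Set ℕ) (Ψ : ι → α → Prop) : Prop :=
  ArithAt (fun _ _ => False) 0 O Ψ

theorem exists_ask {F : ℕ → ℕ → Option ℕ} (hF : Primrec fun p : ℕ × ℕ => F p.1 p.2) :
    ∃ e, ∀ x s, (∃ w, ask e x w = some s) ↔ ∃ y, F x y = some s := by
  have h : Nat.Partrec fun m => ((F m.unpair.1 m.unpair.2 : Option ℕ) : Part ℕ) :=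
    Partrec.nat_iff.1 (Computable.ofOption (Primrec.to_comp (hF.comp Primrec.unpair)))
  obtain ⟨c, hc⟩ := Nat.Partrec.Code.exists_code.1 h
  refine ⟨encode c, fun x s => ?_⟩
  have key : ∀ y, (∃ k, s ∈ Nat.Partrec.Code.evaln k c (pair x y)) ↔ F x y = some s := fun y => by
    rw [← Nat.Partrec.Code.evaln_complete, hc]
    simp
  simp only [ask, Denumerable.ofNat_encode]
  constructor
  · rintro ⟨w, hw⟩
    exact ⟨_, (key _).1 ⟨_, hw⟩⟩
  · rintro ⟨y, hy⟩
    obtain ⟨k, hk⟩ := (key y).2 hy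
    exact ⟨pair k y, by simpa using hk⟩

variable {R : ℕ → ℕ → Prop} {v : ℕ} {O : ι → Set ℕ}

theorem arithAt_of_primrec (hv : Acc R v) {F : ℕ → ℕ → Option ℕ}
    (hF : Primrec fun p : ℕ × ℕ => F p.1 p.2) (m : ℕ)
    (hm : ∀ x y s, F x y = some s →
      R s.unpair.1.unpair.1 v ∨ s.unpair.1.unpair.1 = v ∧ s.unpair.1.unpair.2 ≤ m) :
    ArithAt R v O fun i (x : ℕ) => ∃ y s, F x y = some s ∧ s ∉ hier R (O i) := by
  obtain ⟨e, he⟩ := exists_ask hF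
  -- the index is positive and exceeds `m`, so that all the questions are admissible
  have hlt : m < pair e (m + 1) := Nat.lt_of_lt_of_le (Nat.lt_succ_self m) (Nat.right_le_pair _ _)
  refine ⟨pair e (m + 1), fun i x => ?_⟩
  rw [mem_hier (by simpa using hv)]
  simp only [step, Nat.unpair_pair, encode_nat, lex]
  constructor
  · rintro ⟨y, s, h, hs⟩
    obtain ⟨w, hw⟩ := (he x s).2 ⟨y, h⟩
    exact .inr ⟨by omega, w, s, hw, (hm x y s h).imp_right (And.imp_right fun h => by omega), hs⟩
  · rintro (⟨h, -⟩ | ⟨-, w, s, hw, -, hs⟩)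
    · omega
    · obtain ⟨y, hy⟩ := (he x s).1 ⟨w, hw⟩
      exact ⟨y, s, hy, hs⟩

theorem ArithAt.of_encode {Ψ : ι → α → Prop} {Ψ' : ι → ℕ → Prop} (h : ArithAt R v O Ψ')
    (hΨ : ∀ i a, Ψ i a ↔ Ψ' i (encode a)) : ArithAt R v O Ψ := by
  obtain ⟨n, hn⟩ := h
  exact ⟨n, fun i a => by rw [hΨ, hn, encode_nat]⟩

/-- The universal closure property, from which all others follow: a disjunction over finitely many
negated predicates, an existential quantifier and a substitution in one. -/
theorem ArithAt.exists_not (hv : Acc R v) {k : ℕ} {Ψ : Fin k → ι → β → Prop}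
    (h : ∀ c, ArithAt R v O (Ψ c)) {F : α → ℕ → Option (Fin k × β)}
    (hF : Primrec fun p : α × ℕ => F p.1 p.2) :
    ArithAt R v O fun i a => ∃ y c b, F a y = some (c, b) ∧ ¬ Ψ c i b := by
  choose n hn using h
  let G : ℕ → ℕ → Option ℕ := fun x y => (decode x : Option α).bind fun a =>
    (F a y).map fun t => pair (pair v (n t.1)) (encode t.2)
  have hG : Primrec fun p : ℕ × ℕ => G p.1 p.2 := by
    refine Primrec.option_bind (by fun_prop) ?_
    refine Primrec.option_map (α := (ℕ × ℕ) × α) (β := Fin k × β) (g := fun _ t =>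
      pair (pair v (n t.1)) (encode t.2)) ?_ ?_
    · exact hF.comp (f := fun p : α × ℕ => F p.1 p.2)
        (g := fun p : (ℕ × ℕ) × α => (p.2, p.1.2)) (by fun_prop)
    · have : Primrec n := Primrec.dom_finite n
      unfold Primrec₂
      fun_prop
  refine (arithAt_of_primrec (O := O) hv hG (Finset.univ.sup n) ?_).of_encode fun i a => ?_
  · intro x y s h
    simp only [G, Option.bind_eq_some_iff, Option.map_eq_some_iff] at h
    obtain ⟨a, -, t, -, rfl⟩ := h
    exact .inr ⟨by simp, by simpa using Finset.le_sup (f := n) (Finset.mem_univ t.1)⟩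
  · simp only [G, encodek, Option.bind_some, Option.map_eq_some_iff]
    constructor
    · rintro ⟨y, c, b, h, hb⟩
      exact ⟨y, _, ⟨(c, b), h, rfl⟩, fun h' => hb ((hn c i b).2 h')⟩
    · rintro ⟨y, _, ⟨⟨c, b⟩, h, rfl⟩, hb⟩
      exact ⟨y, c, b, h, fun h' => hb ((hn c i b).1 h')⟩

theorem ArithAt.not_comp (hv : Acc R v) {Ψ : ι → β → Prop} (h : ArithAt R v O Ψ) {f : α → β}
    (hf : Primrec f) : ArithAt R v O fun i a => ¬ Ψ i (f a) := by
  obtain ⟨n, hn⟩ := ArithAt.exists_not (α := α) hv (k := 1) (Ψ := fun _ => Ψ) (fun _ => h)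
    (F := fun a _ => some (0, f a)) (by fun_prop)
  refine ⟨n, fun i a => ?_⟩
  rw [← hn]
  simp

theorem ArithAt.comp (hv : Acc R v) {Ψ : ι → β → Prop} (h : ArithAt R v O Ψ) {f : α → β}
    (hf : Primrec f) : ArithAt R v O fun i a => Ψ i (f a) := by
  simpa using (h.not_comp hv (f := fun a => a) (by fun_prop)).not_comp hv hf

/-- Arithmetical predicates of a set that occurs in the hierarchy along `R` at the node `v` occur
there, too. -/
theorem ArithAt.trans (hv : Acc R v) {A : ι → Set ℕ} (hA : ArithAt R v O fun i x => x ∈ A i)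
    {Ψ : ι → α → Prop} (h : Arith A Ψ) : ArithAt R v O Ψ := by
  obtain ⟨n, hn⟩ := h
  refine ArithAt.of_encode (Ψ' := fun i x => pair (pair 0 n) x ∈ hier (fun _ _ => False) (A i))
    ?_ hn
  clear hn Ψ
  have acc0 : ∀ u : ℕ, Acc (fun _ _ : ℕ => False) u := fun u => ⟨u, fun _ => False.elim⟩
  induction n using Nat.strong_induction_on with
  | _ n ih =>
    rcases Nat.eq_zero_or_pos n with rfl | hpos
    · obtain ⟨m, hm⟩ := hA
      refine ⟨m, fun i a => ?_⟩
      rw [← hm]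
      beta_reduce
      rw [mem_hier (acc0 _)]
      simp [step]
    · -- the questions of the procedure `n` that concern rows `c < n`
      let F : ℕ → ℕ → Option (Fin n × ℕ) := fun x w => (ask n.unpair.1 x w).bind fun s =>
        if s.unpair.1.unpair.1 = 0 then
          (if h : s.unpair.1.unpair.2 < n then some ⟨_, h⟩ else none).map
            fun c => (c, s.unpair.2)
        else none
      have hF : Primrec fun p : ℕ × ℕ => F p.1 p.2 := by
        refine Primrec.option_bind (by fun_prop) ?_
        refine Primrec.ite (α := (ℕ × ℕ) × ℕ) (Primrec.eq.comp (by fun_prop) (by fun_prop))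
          (Primrec.option_map ?_ ?_) (Primrec.const _)
        · have : Primrec fun k : ℕ => (if h : k < n then some ⟨k, h⟩ else none : Option (Fin n)) :=
            ((Primrec.list_getElem?₁ (List.finRange n))).of_eq fun k => by
              split_ifs with h
              · simp [h]
              · simpa using h
          exact this.comp
            (f := fun k : ℕ => (if h : k < n then some ⟨k, h⟩ else none : Option (Fin n)))
            (g := fun p : (ℕ × ℕ) × ℕ => p.2.unpair.1.unpair.2) (by fun_prop)
        · unfold Primrec₂
          fun_prop
      obtain ⟨m, hm⟩ := ArithAt.exists_not (O := O) (α := ℕ) hv (k := n) (Ψ := fun c i x =>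
        pair (pair 0 c) x ∈ hier (fun _ _ => False) (A i)) (fun c => ih c c.2) hF
      refine ⟨m, fun i x => ?_⟩
      rw [← hm]
      beta_reduce
      rw [mem_hier (acc0 _)]
      have hn0 : n ≠ 0 := by omega
      simp only [step, lex, Nat.unpair_pair, hn0, false_and, false_or, ne_eq, not_false_eq_true,
        true_and]
      constructor
      · rintro ⟨w, s, hw, ⟨h0, hlt⟩, hs⟩
        refine ⟨w, ⟨_, hlt⟩, s.unpair.2, by simp [F, hw, h0, hlt], ?_⟩
        have : pair (pair 0 s.unpair.1.unpair.2) s.unpair.2 = s := by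
          rw [← h0, Nat.pair_unpair, Nat.pair_unpair]
        simpa [this] using hs
      · rintro ⟨w, c, b, h, hb⟩
        simp only [F, Option.bind_eq_some_iff] at h
        obtain ⟨s, hs, h⟩ := h
        split_ifs at h with h0 h1
        · simp only [Option.map_some, Option.some.injEq, Prod.mk.injEq] at h
          obtain ⟨rfl, rfl⟩ := h
          refine ⟨w, s, hs, ⟨h0, h1⟩, fun h' => hb ?_⟩
          have : pair (pair 0 s.unpair.1.unpair.2) s.unpair.2 = s := by
            rw [← h0, Nat.pair_unpair, Nat.pair_unpair]
          simpa [this] using h'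
        · simp at h

theorem arithAt_oracle (hv : Acc R v) : ArithAt R v O fun i x => x ∈ O i := by
  refine ⟨0, fun i x => ?_⟩
  rw [mem_hier (by simpa using hv)]
  simp [step]

/-- All rows at a node below `v` together form a set that occurs at `v`. -/
theorem arithAt_lower (hv : Acc R v) {u : ℕ} (hu : R u v) :
    ArithAt R v O fun i (t : ℕ) => pair (pair u t.unpair.1) t.unpair.2 ∈ hier R (O i) := by
  have := arithAt_of_primrec (O := O) hv
    (F := fun t _ => some (pair (pair u t.unpair.1) t.unpair.2)) (by fun_prop) 0
    (fun x y s h => by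
      obtain rfl := Option.some.inj h
      simp [hu])
  simpa using this.not_comp hv (f := fun a => a) (by fun_prop)

theorem acc_false (v : ℕ) : Acc (fun _ _ : ℕ => False) v := ⟨v, fun _ => False.elim⟩

namespace Arith

theorem trans {A : ι → Set ℕ} (hA : Arith O fun i x => x ∈ A i) {Ψ : ι → α → Prop}
    (h : Arith A Ψ) : Arith O Ψ :=
  ArithAt.trans (acc_false 0) hA h

theorem mem {f : α → ℕ} (hf : Primrec f) : Arith O fun i a => f a ∈ O i :=
  ArithAt.comp (acc_false 0) (arithAt_oracle (acc_false 0)) hf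

theorem comp {Ψ : ι → β → Prop} (h : Arith O Ψ) {f : α → β} (hf : Primrec f) :
    Arith O fun i a => Ψ i (f a) :=
  ArithAt.comp (acc_false 0) h hf

theorem mem' {A : ι → Set ℕ} (hA : Arith O fun i x => x ∈ A i) {f : α → ℕ} (hf : Primrec f) :
    Arith O fun i a => f a ∈ A i :=
  hA.comp hf

theorem not {Ψ : ι → α → Prop} (h : Arith O Ψ) : Arith O fun i a => ¬ Ψ i a :=
  ArithAt.not_comp (acc_false 0) h (f := fun a => a) (by fun_prop)

theorem of_iff {Ψ Ψ' : ι → α → Prop} (h : Arith O Ψ) (hΨ : ∀ i a, Ψ' i a ↔ Ψ i a) :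
    Arith O Ψ' := by
  obtain ⟨n, hn⟩ := h
  exact ⟨n, fun i a => by rw [hΨ, hn]⟩

theorem ex {Ψ : ι → α → β → Prop} (h : Arith O fun i (p : α × β) => Ψ i p.1 p.2) :
    Arith O fun i a => ∃ b, Ψ i a b := by
  refine of_iff (ArithAt.exists_not (acc_false 0) (k := 1) (fun _ => h.not)
    (F := fun a y => (decode y).map fun b => (0, (a, b))) ?_) fun i a => ?_
  · refine Primrec.option_map (by fun_prop) ?_
    unfold Primrec₂
    fun_prop
  · constructor
    · rintro ⟨b, hb⟩
      exact ⟨encode b, 0, (a, b), by simp, by simpa using hb⟩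
    · rintro ⟨y, c, ⟨a', b⟩, h, hb⟩
      simp only [Option.map_eq_some_iff, Prod.mk.injEq] at h
      obtain ⟨b, -, -, rfl, rfl⟩ := h
      exact ⟨_, not_not.1 hb⟩

theorem all {Ψ : ι → α → β → Prop} (h : Arith O fun i (p : α × β) => Ψ i p.1 p.2) :
    Arith O fun i a => ∀ b, Ψ i a b :=
  (ex (Ψ := fun i a b => ¬ Ψ i a b) h.not).not.of_iff fun i a => by simp

theorem or {Ψ Ψ' : ι → α → Prop} (h : Arith O Ψ) (h' : Arith O Ψ') :
    Arith O fun i a => Ψ i a ∨ Ψ' i a := by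
  refine of_iff (ArithAt.exists_not (acc_false 0) (k := 2) (β := α)
    (Ψ := ![fun i a => ¬ Ψ i a, fun i a => ¬ Ψ' i a]) ?_
    (F := fun a y => some (if y = 0 then 0 else 1, a)) ?_) fun i a => ?_
  · intro c
    fin_cases c
    exacts [h.not, h'.not]
  · refine primrec_some (primrec_mk (Primrec.ite ?_ (by fun_prop) (by fun_prop)) (by fun_prop))
    exact Primrec.eq.comp (by fun_prop) (by fun_prop)
  · constructor
    · rintro (h | h)
      · exact ⟨0, 0, a, by simp, by simpa using h⟩
      · exact ⟨1, 1, a, by simp, by simpa using h⟩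
    · rintro ⟨y, c, b, h, hb⟩
      simp only [Option.some.injEq, Prod.mk.injEq] at h
      obtain ⟨rfl, rfl⟩ := h
      split_ifs at hb
      · exact .inl (by simpa using hb)
      · exact .inr (by simpa using hb)

theorem and {Ψ Ψ' : ι → α → Prop} (h : Arith O Ψ) (h' : Arith O Ψ') :
    Arith O fun i a => Ψ i a ∧ Ψ' i a :=
  (h.not.or h'.not).not.of_iff fun i a => by simp

theorem imp {Ψ Ψ' : ι → α → Prop} (h : Arith O Ψ) (h' : Arith O Ψ') :
    Arith O fun i a => Ψ i a → Ψ' i a :=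
  (h.not.or h').of_iff fun i a => by tauto

theorem iff {Ψ Ψ' : ι → α → Prop} (h : Arith O Ψ) (h' : Arith O Ψ') :
    Arith O fun i a => (Ψ i a ↔ Ψ' i a) :=
  ((h.imp h').and (h'.imp h)).of_iff fun i a => by tauto

theorem prim {p : α → Prop} (hp : PrimrecPred p) : Arith O fun _ a => p a := by
  classical
  have htrue : Arith O fun _ (_ : ℕ) => True :=
    ((mem (f := fun x : ℕ => x) (by fun_prop)).or
      (mem (f := fun x : ℕ => x) (by fun_prop)).not).of_iff fun i x => by simp [Classical.em]
  refine of_iff (ArithAt.exists_not (acc_false 0) (k := 2) (β := ℕ)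
    (Ψ := ![fun _ _ => True, fun _ _ => ¬ True]) ?_
    (F := fun a _ => some (if p a then 1 else 0, 0)) ?_) fun i a => ?_
  · intro c
    fin_cases c
    exacts [htrue, htrue.not]
  · refine primrec_some (primrec_mk (Primrec.ite ?_ (by fun_prop) (by fun_prop)) (by fun_prop))
    exact hp.comp (by fun_prop)
  · by_cases hp : p a <;> simp [hp]

theorem eq {f g : α → β} (hf : Primrec f) (hg : Primrec g) : Arith O fun _ a => f a = g a :=
  prim (Primrec.eq.comp hf hg)

theorem lt {f g : α → ℕ} (hf : Primrec f) (hg : Primrec g) : Arith O fun _ a => f a < g a :=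
  prim (Primrec.nat_lt.comp hf hg)

theorem le {f g : α → ℕ} (hf : Primrec f) (hg : Primrec g) : Arith O fun _ a => f a ≤ g a :=
  prim (Primrec.nat_le.comp hf hg)

end Arith

end Arith

/-! ### Arithmetical ideals and universal sets -/

/-- The predicate `p` is arithmetical in `B`. -/
abbrev ArithIn {α : Type} [Primcodable α] (B : Set ℕ) (p : α → Prop) : Prop :=
  Arith (fun _ : Unit => B) fun _ => p

/-- The set `A` is arithmetical in `B`. -/
abbrev RedTo (A B : Set ℕ) : Prop := ArithIn B fun x => x ∈ A

theorem RedTo.refl (A : Set ℕ) : RedTo A A := Arith.mem (f := fun x : ℕ => x) (by fun_prop)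

theorem Arith.reindex {ι κ α : Type} [Primcodable α] {O : ι → Set ℕ} {Ψ : ι → α → Prop}
    (h : Arith O Ψ) (f : κ → ι) : Arith (fun k => O (f k)) fun k => Ψ (f k) := by
  obtain ⟨n, hn⟩ := h
  exact ⟨n, fun k a => hn (f k) a⟩

/-- A predicate that is arithmetical in a set, which is itself arithmetical in the oracle. -/
theorem ArithIn.of_redTo {ι α : Type} [Primcodable α] {O : ι → Set ℕ} {B : Set ℕ} {p : α → Prop}
    (h : ArithIn B p) (hB : Arith O fun _ (x : ℕ) => x ∈ B) : Arith O fun _ => p :=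
  Arith.trans (A := fun _ => B) hB (h.reindex (κ := ι) fun _ => ())

theorem RedTo.trans {A B C : Set ℕ} (h : RedTo A B) (h' : RedTo B C) : RedTo A C :=
  ArithIn.of_redTo h h'

theorem redTo_row {A P : Set ℕ} {n : ℕ} (h : A = row P n) : RedTo A P := by
  subst h
  exact Arith.mem (f := fun x : ℕ => pair n x) (by fun_prop)

theorem Arith.mem_finite {ι : Type} {O : ι → Set ℕ} {F : Set ℕ} (hF : F.Finite) :
    Arith O fun _ (x : ℕ) => x ∈ F := by
  induction F, hF using Set.Finite.induction_on with
  | empty => exact (Arith.lt (f := fun x : ℕ => x) (g := fun x => x) (by fun_prop)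
      (by fun_prop)).of_iff (by simp)
  | @insert a F _ _ ih =>
    exact ((Arith.eq (f := fun x : ℕ => x) (g := fun _ => a) (by fun_prop) (by fun_prop)).or
      ih).of_iff (by simp)

/-- The join of two sets. -/
def join (A B : Set ℕ) : Set ℕ :=
  {n | n.unpair.1 = 0 ∧ n.unpair.2 ∈ A ∨ n.unpair.1 = 1 ∧ n.unpair.2 ∈ B}

theorem arith_join_left {ι : Type} (A B : ι → Set ℕ) :
    Arith (fun i => join (A i) (B i)) fun i x => x ∈ A i :=
  (Arith.mem (f := fun x : ℕ => pair 0 x) (by fun_prop)).of_iff (by simp [join])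

theorem arith_join_right {ι : Type} (A B : ι → Set ℕ) :
    Arith (fun i => join (A i) (B i)) fun i x => x ∈ B i :=
  (Arith.mem (f := fun x : ℕ => pair 1 x) (by fun_prop)).of_iff (by simp [join])

theorem Arith.join {ι : Type} {O A B : ι → Set ℕ} (hA : Arith O fun i x => x ∈ A i)
    (hB : Arith O fun i x => x ∈ B i) : Arith O fun i x => x ∈ join (A i) (B i) :=
  .or (.and (.eq (by fun_prop) (by fun_prop)) (.mem' hA (by fun_prop)))
    (.and (.eq (by fun_prop) (by fun_prop)) (.mem' hB (by fun_prop)))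

theorem redTo_join_left (A B : Set ℕ) : RedTo A (join A B) :=
  arith_join_left (fun _ => A) fun _ => B

theorem redTo_join_right (A B : Set ℕ) : RedTo B (join A B) :=
  arith_join_right (fun _ => A) fun _ => B

/-- A nonempty family of sets that is closed under joins and arithmetical definability. -/
structure IsIdeal (D : Set (Set ℕ)) : Prop where
  nonempty : D.Nonempty
  join_mem : ∀ A ∈ D, ∀ B ∈ D, join A B ∈ D
  mem_of_redTo : ∀ A ∈ D, ∀ B, RedTo B A → B ∈ D

/-- The ideal of the sets that are arithmetical in `B`. -/
def below (B : Set ℕ) : Set (Set ℕ) := {A | RedTo A B}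

theorem isIdeal_below (B : Set ℕ) : IsIdeal (below B) where
  nonempty := ⟨B, .refl B⟩
  join_mem _ hA _ hB := Arith.join hA hB
  mem_of_redTo _ hA _ h := RedTo.trans h hA

namespace IsIdeal

variable {D : Set (Set ℕ)}

theorem exists_oracle₂ (hD : IsIdeal D) {A B : Set ℕ} (hA : A ∈ D) (hB : B ∈ D) :
    ∃ C ∈ D, RedTo A C ∧ RedTo B C :=
  ⟨join A B, hD.join_mem A hA B hB, redTo_join_left A B, redTo_join_right A B⟩

theorem union_mem (hD : IsIdeal D) {A B : Set ℕ} (hA : A ∈ D) (hB : B ∈ D) : A ∪ B ∈ D := by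
  obtain ⟨C, hC, h₁, h₂⟩ := hD.exists_oracle₂ hA hB
  exact hD.mem_of_redTo C hC _ (h₁.or h₂)

theorem mem_of_arithIn (hD : IsIdeal D) {A : Set ℕ} (hA : A ∈ D) {B : Set ℕ}
    (h : ArithIn A fun x => x ∈ B) : B ∈ D :=
  hD.mem_of_redTo A hA B h

end IsIdeal

/-- Every member of `D` is a row of `P`. -/
def Covers (D : Set (Set ℕ)) (P : Set ℕ) : Prop := ∀ A ∈ D, ∃ n, A = row P n

/-- The members of `D` are exactly the rows of `P`. -/
def Enumerates (D : Set (Set ℕ)) (P : Set ℕ) : Prop := D = Set.range (row P)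

theorem Enumerates.covers {D : Set (Set ℕ)} {P : Set ℕ} (h : Enumerates D P) : Covers D P := by
  intro A hA
  rw [h] at hA
  exact hA.imp fun n hn => hn.symm

theorem Covers.redTo {D : Set (Set ℕ)} {P A : Set ℕ} (h : Covers D P) (hA : A ∈ D) :
    RedTo A P :=
  redTo_row (h A hA).choose_spec

/-- Cantor's diagonal argument. -/
theorem Covers.notMem {D : Set (Set ℕ)} {P : Set ℕ} (h : Covers D P) (hD : IsIdeal D) :
    P ∉ D := by
  intro hP
  have : {n | pair n n ∉ P} ∈ D :=
    hD.mem_of_arithIn hP (Arith.not (.mem (f := fun n : ℕ => pair n n) (by fun_prop)))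
  obtain ⟨n, hn⟩ := h _ this
  have := Set.ext_iff.1 hn n
  simp at this

/-! ### Recursion inside an ideal -/

/-- The operator `Φ` is arithmetical in `B`: it can be evaluated, arithmetically in `B`, at the rows
of a given set. -/
def ArithOp (B : Set ℕ) (Φ : Set ℕ → ℕ → ℕ → Prop) : Prop :=
  ∀ P C, RedTo P C → RedTo B C →
    ArithIn C fun a : ℕ × ℕ × ℕ => Φ (row P a.1) a.2.1 a.2.2

section Recursion

variable {r : ℕ → ℕ → Prop} {Φ : Set ℕ → ℕ → ℕ → Prop} {B C P : Set ℕ}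

theorem ArithOp.isApprox (hΦ : ArithOp B Φ) (hrB : ArithIn B fun a : ℕ × ℕ => r a.1 a.2)
    (hP : RedTo P C) (hB : RedTo B C) :
    ArithIn C fun a : ℕ × ℕ => IsApprox r Φ a.2 (row P a.1) := by
  have hr := hrB.of_redTo hB
  refine .all (.imp (.or (.eq (by fun_prop) (by fun_prop)) ?_) (.all (.iff ?_ ?_)))
  · exact hr.comp (f := fun x : (ℕ × ℕ) × ℕ => (x.2, x.1.2)) (by fun_prop)
  · exact Arith.mem' hP (f := fun x : ((ℕ × ℕ) × ℕ) × ℕ => pair x.1.1.1 (pair x.1.2 x.2))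
      (by fun_prop)
  · exact (hΦ P C hP hB).comp (f := fun x : ((ℕ × ℕ) × ℕ) × ℕ => (x.1.1.1, x.1.2, x.2))
      (by fun_prop)

/-- If the initial parts of the solution belong to `D`, then they can be found among the rows of a
set that covers `D`: they are recognized by the recursion equation. -/
theorem redTo_solution_of_covers (hl : IsLocal r Φ) (hr : ∀ a b c, r a b → r b c → r a c)
    (hΦ : ArithOp B Φ) (hrB : ArithIn B fun a : ℕ × ℕ => r a.1 a.2) {D : Set (Set ℕ)}
    (hP : Covers D P) {S : ℕ → Prop} (hS : ∀ q, S q → Acc r q ∧ solutionUpTo r Φ q ∈ D)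
    (hPC : RedTo P C) (hBC : RedTo B C) (hSC : ArithIn C S) :
    RedTo {t | S t.unpair.1 ∧ t ∈ solution r Φ} C := by
  have h : ArithIn C fun t : ℕ => S t.unpair.1 ∧
      ∃ n : ℕ, IsApprox r Φ t.unpair.1 (row P n) ∧ t ∈ row P n := by
    refine .and (hSC.comp (by fun_prop)) (.ex (.and ?_ ?_))
    · exact (hΦ.isApprox hrB hPC hBC).comp (f := fun x : ℕ × ℕ => (x.2, x.1.unpair.1))
        (by fun_prop)
    · exact Arith.mem' hPC (f := fun x : ℕ × ℕ => pair x.2 x.1) (by fun_prop)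
  refine h.of_iff fun _ t => and_congr_right fun ht => ?_
  obtain ⟨hacc, hmem⟩ := hS _ ht
  constructor
  · intro hsol
    obtain ⟨n, hn⟩ := hP _ hmem
    refine ⟨n, ?_, ?_⟩
    · rw [← hn]
      exact isApprox_solutionUpTo hl hr hacc
    · rw [← hn]
      exact ⟨.inl rfl, hsol⟩
  · rintro ⟨n, hn, htn⟩
    have := Set.ext_iff.1 (hn.row_eq hl hr hacc (.inl rfl)) t.unpair.2
    simp only [mem_row, Nat.pair_unpair] at this
    exact this.1 htn

/-- The rows below `p` determine the row at `p`, arithmetically in `B`. -/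
theorem solutionUpTo_mem_of_lt {D : Set (Set ℕ)} (hD : IsIdeal D) (hl : IsLocal r Φ)
    (hΦ : ArithOp B Φ) (hB : B ∈ D) {p : ℕ}
    (hp : Acc r p) (h : {t | r t.unpair.1 p ∧ t ∈ solution r Φ} ∈ D) :
    solutionUpTo r Φ p ∈ D := by
  obtain ⟨C, hC, hYC, hBC⟩ := hD.exists_oracle₂ h hB
  set Y := {t | r t.unpair.1 p ∧ t ∈ solution r Φ} with hY
  have h₁ : RedTo {s | s.unpair.2 ∈ Y} C := hYC.comp (f := fun s : ℕ => s.unpair.2) (by fun_prop)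
  have h₂ : RedTo {t | t ∈ Y ∨ t.unpair.1 = p ∧
      Φ (row {s | s.unpair.2 ∈ Y} 0) t.unpair.1 t.unpair.2} C :=
    .or hYC (.and (.eq (by fun_prop) (by fun_prop)) ((hΦ _ C h₁ hBC).comp
      (f := fun t : ℕ => (0, t.unpair.1, t.unpair.2)) (by fun_prop)))
  convert hD.mem_of_redTo C hC _ h₂ using 1
  ext t
  have hΦt : t.unpair.1 = p → (t ∈ solution r Φ ↔
      Φ (row {s | s.unpair.2 ∈ Y} 0) t.unpair.1 t.unpair.2) := fun ht => by
    have := mem_solution hl (ht ▸ hp : Acc r t.unpair.1) t.unpair.2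
    rw [Nat.pair_unpair] at this
    rw [this]
    refine hl _ _ _ _ fun q hq => ?_
    ext x
    rw [ht] at hq
    simp [hY, hq]
  simp only [solutionUpTo, Set.mem_ofPred_eq]
  constructor
  · rintro ⟨h | h, h'⟩
    exacts [.inr ⟨h, (hΦt h).1 h'⟩, .inl ⟨h, h'⟩]
  · rintro (h | ⟨h, h'⟩)
    exacts [⟨.inr h.1, h.2⟩, ⟨.inl h, (hΦt h).2 h'⟩]

theorem solution_mem_of_finite {D : Set (Set ℕ)} (hD : IsIdeal D) {F : Set ℕ} (hF : F.Finite)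
    (h : ∀ q ∈ F, solutionUpTo r Φ q ∈ D) :
    {t | t.unpair.1 ∈ F ∧ t ∈ solution r Φ} ∈ D := by
  induction F, hF using Set.Finite.induction_on with
  | empty =>
    obtain ⟨A, hA⟩ := hD.nonempty
    refine hD.mem_of_arithIn hA ((Arith.lt (f := fun x : ℕ => x) (g := fun x => x) (by fun_prop)
      (by fun_prop)).of_iff (by simp))
  | @insert a F _ _ ih =>
    have h₁ := h a (Set.mem_insert a F)
    have h₂ : {t | t.unpair.1 = a ∧ t ∈ solutionUpTo r Φ a} ∈ D :=
      hD.mem_of_arithIn h₁ (.and (.eq (f := fun t : ℕ => t.unpair.1) (by fun_prop) (by fun_prop))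
        (.mem (by fun_prop)))
    convert hD.union_mem h₂ (ih fun q hq => h q (Set.mem_insert_of_mem a hq)) using 1
    ext t
    simp only [solutionUpTo, Set.mem_union, Set.mem_ofPred_eq, Set.mem_insert_iff]
    tauto

end Recursion

/-! ### Towers of ideals -/

/-- The families `D α`, `α ≤ lam`, start with the sets arithmetical in `B`; at successors, the
family `D α` is extended by a set `P α` that covers it and is arithmetical in every other set that
covers it; at limits, unions are taken. -/
structure IsTower (lam : Ordinal.{0}) (B : Set ℕ) (D : Ordinal.{0} → Set (Set ℕ))
    (P : Ordinal.{0} → Set ℕ) : Prop where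
  zero : D 0 = below B
  succ : ∀ α < lam, D (Order.succ α) = below (P α)
  covers : ∀ α < lam, Covers (D α) (P α)
  least : ∀ α < lam, ∀ Q, Covers (D α) Q → RedTo (P α) Q
  limit : ∀ β ≤ lam, Order.IsSuccLimit β → D β = ⋃ α < β, D α

namespace IsTower

variable {lam : Ordinal.{0}} {B : Set ℕ} {D : Ordinal.{0} → Set (Set ℕ)} {P : Ordinal.{0} → Set ℕ}

theorem mono (T : IsTower lam B D P) {α β : Ordinal} (h : α ≤ β) (hβ : β ≤ lam) :
    D α ⊆ D β := by
  induction β using Ordinal.limitRecOn generalizing α with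
  | zero => rw [nonpos_iff_eq_zero.1 h]
  | add_one β ih =>
    rw [← Order.succ_eq_add_one] at h hβ ⊢
    rcases h.eq_or_lt with rfl | h
    · rfl
    · have hlt : β < lam := (Order.lt_succ β).trans_le hβ
      refine (ih (Order.lt_succ_iff.1 h) hlt.le).trans fun A hA => ?_
      rw [T.succ β hlt]
      exact (T.covers β hlt).redTo hA
  | limit β hlim ih =>
    rcases h.eq_or_lt with rfl | h
    · rfl
    · rw [T.limit β hβ hlim]
      exact Set.subset_biUnion_of_mem (u := D) (show α ∈ {α | α < β} from h)

theorem isIdeal (T : IsTower lam B D P) {β : Ordinal} (hβ : β ≤ lam) : IsIdeal (D β) := by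
  induction β using Ordinal.limitRecOn with
  | zero => rw [T.zero]; exact isIdeal_below B
  | add_one β ih =>
    rw [← Order.succ_eq_add_one] at hβ ⊢
    rw [T.succ β ((Order.lt_succ β).trans_le hβ)]; exact isIdeal_below _
  | limit β hlim ih =>
    have hmem : ∀ A, A ∈ D β ↔ ∃ α < β, A ∈ D α := fun A => by
      rw [T.limit β hβ hlim]; simp
    have ih' : ∀ α < β, IsIdeal (D α) := fun α h => ih α h (h.le.trans hβ)
    refine ⟨?_, fun A hA A' hA' => ?_, fun A hA A' h => ?_⟩
    · obtain ⟨A, hA⟩ := (ih' 0 (by simpa using hlim.bot_lt)).nonempty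
      exact ⟨A, (hmem A).2 ⟨0, by simpa using hlim.bot_lt, hA⟩⟩
    · obtain ⟨α, hα, hA⟩ := (hmem A).1 hA
      obtain ⟨α', hα', hA'⟩ := (hmem A').1 hA'
      have hlt : max α α' < β := max_lt hα hα'
      exact (hmem _).2 ⟨_, hlt, (ih' _ hlt).join_mem _ (T.mono (le_max_left _ _)
        (hlt.le.trans hβ) hA) _ (T.mono (le_max_right _ _) (hlt.le.trans hβ) hA')⟩
    · obtain ⟨α, hα, hA⟩ := (hmem A).1 hA
      exact (hmem _).2 ⟨α, hα, (ih' α hα).mem_of_redTo A hA A' h⟩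

theorem oracle_mem (T : IsTower lam B D P) {β : Ordinal} (hβ : β ≤ lam) : B ∈ D β :=
  T.mono zero_le hβ (by rw [T.zero]; exact .refl B)

/-- Recursion along a relation that is arithmetical in `B` does not lead further up in the tower
than its rank. More generally, finitely many predecessors may be on the same level. -/
theorem solutionUpTo_mem (T : IsTower lam B D P) {r : ℕ → ℕ → Prop}
    {Φ : Set ℕ → ℕ → ℕ → Prop} (hl : IsLocal r Φ) (hr : ∀ a b c, r a b → r b c → r a c)
    (hΦ : ArithOp B Φ) (hrB : ArithIn B fun a : ℕ × ℕ => r a.1 a.2) {W : ℕ → Prop}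
    (hW : ∀ p, W p → Acc r p) (hW' : ∀ p q, W p → r q p → W q) {lev : ℕ → Ordinal.{0}}
    (hlam : ∀ p, W p → lev p < lam) (hlev : ∀ p q, W p → r q p → lev q ≤ lev p)
    (hfin : ∀ p, W p → {q | r q p ∧ lev q = lev p}.Finite) {p : ℕ} (hp : W p) :
    solutionUpTo r Φ p ∈ D (Order.succ (lev p)) := by
  have hacc := hW p hp
  induction hacc with
  | intro p _ ih =>
    have hlt := hlam p hp
    have hle : Order.succ (lev p) ≤ lam := Order.succ_le_of_lt hlt
    have hD := T.isIdeal hle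
    have hPD : P (lev p) ∈ D (Order.succ (lev p)) := by
      rw [T.succ _ hlt]; exact .refl _
    have hBP : RedTo B (P (lev p)) := (T.covers _ hlt).redTo (T.oracle_mem hlt.le)
    refine solutionUpTo_mem_of_lt hD hl hΦ (T.oracle_mem hle) (hW p hp) ?_
    set F := {q | r q p ∧ lev q = lev p} with hF
    have hZ := solution_mem_of_finite (Φ := Φ) hD (hfin p hp) fun q hq => by
      have := ih q hq.1 (hW' p q hp hq.1)
      rwa [hq.2] at this
    have hY := redTo_solution_of_covers (S := fun q => r q p ∧ q ∉ F) hl hr hΦ hrB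
      (T.covers _ hlt) (fun q hq => ⟨hW q (hW' p q hp hq.1), by
        have hqp : lev q < lev p := (hlev p q hp hq.1).lt_of_ne fun h => hq.2 ⟨hq.1, h⟩
        exact T.mono (Order.succ_le_of_lt hqp) hlt.le (ih q hq.1 (hW' p q hp hq.1))⟩)
      (.refl _) hBP (.and ((hrB.of_redTo hBP).comp (f := fun q => (q, p)) (by fun_prop))
        (Arith.mem_finite (hfin p hp)).not)
    convert hD.union_mem (hD.mem_of_redTo _ hPD _ hY) hZ using 1
    ext t
    simp only [Set.mem_union, Set.mem_ofPred_eq, hF]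
    tauto

end IsTower

/-! ### Definability of the hierarchy -/

section Definability

variable {ι α : Type} [Primcodable α] {O : ι → Set ℕ} {R : ι → α → ℕ → ℕ → Prop}

theorem Arith.lex (hR : Arith O fun i (a : α × ℕ × ℕ) => R i a.1 a.2.1 a.2.2) {f g : α → ℕ}
    (hf : Primrec f) (hg : Primrec g) : Arith O fun i a => lex (R i a) (f a) (g a) :=
  .or (hR.comp (f := fun a => (a, (f a).unpair.1, (g a).unpair.1)) (by fun_prop))
    (.and (.eq (by fun_prop) (by fun_prop)) (.lt (by fun_prop) (by fun_prop)))

theorem Arith.step (hR : Arith O fun i (a : α × ℕ × ℕ) => R i a.1 a.2.1 a.2.2) {B : ι → Set ℕ}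
    (hB : Arith O fun i x => x ∈ B i) {X : ι → α → Set ℕ}
    (hX : Arith O fun i (a : α × ℕ) => a.2 ∈ X i a.1) {f g : α → ℕ}
    (hf : Primrec f) (hg : Primrec g) :
    Arith O fun i a => step (R i a) (B i) (X i a) (f a) (g a) := by
  refine .or (.and (.eq (by fun_prop) (by fun_prop)) (.mem' hB hg))
    (.and (.not (.eq (by fun_prop) (by fun_prop))) (.ex (.ex (.and ?_ (.and ?_ (.not ?_))))))
  · exact .eq (f := fun a : (α × ℕ) × ℕ => ask (f a.1.1).unpair.2.unpair.1 (g a.1.1) a.1.2)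
      (by fun_prop) (by fun_prop)
  · exact Arith.lex (R := fun i (a : (α × ℕ) × ℕ) => R i a.1.1) (hR.comp
      (f := fun a : ((α × ℕ) × ℕ) × ℕ × ℕ => (a.1.1.1, a.2)) (by fun_prop))
      (by fun_prop) (by fun_prop)
  · exact hX.comp (f := fun a : (α × ℕ) × ℕ => (a.1.1, a.2)) (by fun_prop)

theorem Arith.isApprox_step (hR : Arith O fun i (a : α × ℕ × ℕ) => R i a.1 a.2.1 a.2.2)
    {B : ι → Set ℕ} (hB : Arith O fun i x => x ∈ B i) {X : ι → α → Set ℕ}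
    (hX : Arith O fun i (a : α × ℕ) => a.2 ∈ X i a.1) {f : α → ℕ} (hf : Primrec f) :
    Arith O fun i a => IsApprox (TarskiHierarchy.lex (R i a)) (TarskiHierarchy.step (R i a) (B i))
      (f a) (X i a) := by
  refine .all (.imp (.or (.eq (by fun_prop) (by fun_prop)) ?_) (.all (.iff ?_ ?_)))
  · exact Arith.lex (R := fun i (a : α × ℕ) => R i a.1) (hR.comp
      (f := fun a : (α × ℕ) × ℕ × ℕ => (a.1.1, a.2)) (by fun_prop)) (by fun_prop) (by fun_prop)
  · exact hX.comp (f := fun a : (α × ℕ) × ℕ => (a.1.1, pair a.1.2 a.2)) (by fun_prop)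
  · exact Arith.step (R := fun i (a : (α × ℕ) × ℕ) => R i a.1.1)
      (X := fun i (a : (α × ℕ) × ℕ) => X i a.1.1) (hR.comp
      (f := fun a : ((α × ℕ) × ℕ) × ℕ × ℕ => (a.1.1.1, a.2)) (by fun_prop)) hB (hX.comp
      (f := fun a : ((α × ℕ) × ℕ) × ℕ => (a.1.1.1, a.2)) (by fun_prop)) (by fun_prop)
      (by fun_prop)

theorem arithOp_step {R : ℕ → ℕ → Prop} {B : Set ℕ}
    (hR : ArithIn B fun a : ℕ × ℕ => R a.1 a.2) : ArithOp B (TarskiHierarchy.step R B) :=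
  fun _ _ hP hB => Arith.step (R := fun _ _ => R) (B := fun _ => B)
    (X := fun _ a => row _ a.1) ((hR.of_redTo hB).comp
    (f := fun a : (ℕ × ℕ × ℕ) × ℕ × ℕ => a.2) (by fun_prop)) hB
    (Arith.mem' hP (f := fun a : (ℕ × ℕ × ℕ) × ℕ => pair a.1.1 a.2) (by fun_prop))
    (by fun_prop) (by fun_prop)

theorem arithIn_lex {R : ℕ → ℕ → Prop} {B : Set ℕ}
    (hR : ArithIn B fun a : ℕ × ℕ => R a.1 a.2) : ArithIn B fun a : ℕ × ℕ => lex R a.1 a.2 :=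
  Arith.lex (R := fun _ _ => R) (hR.comp (f := fun a : (ℕ × ℕ) × ℕ × ℕ => a.2) (by fun_prop))
    (by fun_prop) (by fun_prop)

end Definability

/-! ### Principal ideals -/

/-- The truth set for arithmetic with oracle `B`. -/
def truth (B : Set ℕ) : Set ℕ :=
  {t | pair (pair 0 t.unpair.1) t.unpair.2 ∈ hier (fun _ _ => False) B}

theorem arith_iff_truth {ι α : Type} [Primcodable α] {O : ι → Set ℕ} {Ψ : ι → α → Prop} :
    Arith O Ψ ↔ ∃ n, ∀ i a, Ψ i a ↔ pair n (encode a) ∈ truth (O i) := by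
  simp [Arith, ArithAt, truth]

theorem enumerates_truth (B : Set ℕ) : Enumerates (below B) (truth B) := by
  ext A
  simp only [below, RedTo, ArithIn, Set.mem_ofPred_eq, arith_iff_truth, Set.mem_range, Set.ext_iff,
    mem_row, encode_nat]
  exact exists_congr fun n => ⟨fun h x => (h () x).symm, fun h _ x => (h x).symm⟩

/-- The truth set is arithmetical in every set that covers the arithmetical sets. -/
theorem truth_redTo {B P : Set ℕ} (hP : Covers (below B) P) : RedTo (truth B) P := by
  have hB : RedTo B P := hP.redTo (.refl B)
  have hR : ArithIn B fun a : ℕ × ℕ => (fun _ _ : ℕ => False) a.1 a.2 :=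
    (Arith.lt (f := fun a : ℕ × ℕ => a.1) (g := fun a => a.1) (by fun_prop) (by fun_prop)).of_iff
      (by simp)
  have hacc : ∀ q : ℕ, Acc (lex fun _ _ => False) q := fun q => acc_lex (acc_false _)
  have key : ∀ n : ℕ, ∀ q : ℕ, q.unpair = (0, n) →
      solutionUpTo (lex fun _ _ => False) (step (fun _ _ => False) B) q ∈ below B := by
    intro n
    induction n using Nat.strong_induction_on with
    | _ n ih =>
      intro q hq
      refine solutionUpTo_mem_of_lt (isIdeal_below B) (isLocal_step _ _) (arithOp_step hR) (.refl B)
        (hacc q) ?_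
      refine solution_mem_of_finite (F := {s | lex (fun _ _ => False) s q}) (isIdeal_below B)
        ?_ fun s hs => ?_
      · refine ((Set.finite_Iio n).image (pair 0)).subset fun s hs => ?_
        simp only [lex, hq, false_or, Set.mem_ofPred_eq] at hs
        exact ⟨s.unpair.2, hs.2, by rw [← hs.1, Nat.pair_unpair]⟩
      · simp only [lex, hq, false_or, Set.mem_ofPred_eq] at hs
        exact ih _ hs.2 s (Prod.ext hs.1 rfl)
  have := redTo_solution_of_covers (S := fun q => q.unpair.1 = 0) (C := P) (isLocal_step _ B)
    (lex_trans fun _ _ _ h _ => h) (arithOp_step hR) (arithIn_lex hR) hP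
    (fun q hq => ⟨hacc q, key q.unpair.2 q (Prod.ext hq rfl)⟩) (.refl P) hB
    (.eq (by fun_prop) (by fun_prop))
  refine (this.comp (f := fun t : ℕ => pair (pair 0 t.unpair.1) t.unpair.2)
    (by fun_prop)).of_iff fun _ t => ?_
  simp [truth, hier]

/-! ### The hierarchy in a tower -/

/-- The rank of an accessible point, and `0` elsewhere. -/
noncomputable def rk (R : ℕ → ℕ → Prop) (v : ℕ) : Ordinal.{0} :=
  open Classical in if h : Acc R v then h.rank else 0

section Rank

variable {R : ℕ → ℕ → Prop} {u v : ℕ}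

theorem rk_lt (hv : Acc R v) (h : R u v) : rk R u < rk R v := by
  rw [rk, rk, dif_pos hv, dif_pos (hv.inv h)]
  exact hv.rank_lt_of_rel h

theorem exists_rk_eq (hR : ∀ a b c, R a b → R b c → R a c) (hv : Acc R v) {o : Ordinal.{0}}
    (ho : o < rk R v) : ∃ u, R u v ∧ rk R u = o := by
  induction hv with
  | intro v hv ih =>
    have hv' : Acc R v := ⟨v, hv⟩
    have ho' := ho
    rw [rk, dif_pos hv', Acc.rank_eq, Ordinal.lt_iSup_iff] at ho'
    obtain ⟨⟨u, hu⟩, h⟩ := ho'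
    have h' : o ≤ rk R u := by
      rw [rk, dif_pos (hv u hu)]
      exact Order.lt_succ_iff.1 h
    rcases h'.eq_or_lt with h' | h'
    · exact ⟨u, hu, h'.symm⟩
    · obtain ⟨w, hw, rfl⟩ := ih u hu h'
      exact ⟨w, hR _ _ _ hw hu, rfl⟩

end Rank

namespace IsTower

variable {lam : Ordinal.{0}} {B : Set ℕ} {D : Ordinal.{0} → Set (Set ℕ)} {P : Ordinal.{0} → Set ℕ}
  {R : ℕ → ℕ → Prop} {v : ℕ}

/-- The ideal `D α` of the tower is contained in the family of the rows at a node of rank `α`. -/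
theorem arithAt_of_mem (T : IsTower lam B D P) (hR : ∀ a b c, R a b → R b c → R a c)
    (hv : Acc R v) (hlam : rk R v ≤ lam) {A : Set ℕ} (hA : A ∈ D (rk R v)) :
    ArithAt R v (fun _ : Unit => B) fun _ x => x ∈ A := by
  induction hv generalizing A with
  | intro v hacc ih =>
    have hv : Acc R v := ⟨v, hacc⟩
    -- the rows at a node `u` below `v`
    have hcov : ∀ u, R u v → Covers (D (rk R u))
        {t | pair (pair u t.unpair.1) t.unpair.2 ∈ hier R B} := fun u hu A hA => by
      obtain ⟨n, hn⟩ := ih u hu ((rk_lt hv hu).le.trans hlam) hA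
      refine ⟨n, ?_⟩
      ext x
      simpa using hn () x
    have hlow : ∀ u, R u v → ∀ A, RedTo A {t | pair (pair u t.unpair.1) t.unpair.2 ∈ hier R B} →
        ArithAt R v (fun _ : Unit => B) fun _ x => x ∈ A := fun u hu A hA =>
      ArithAt.trans hv (A := fun _ : Unit => {t | pair (pair u t.unpair.1) t.unpair.2 ∈ hier R B})
        (arithAt_lower hv hu) hA
    rcases Ordinal.zero_or_succ_or_isSuccLimit (rk R v) with h | ⟨γ, h⟩ | h
    · rw [h, T.zero] at hA
      exact ArithAt.trans hv (A := fun _ : Unit => B) (arithAt_oracle hv) hA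
    · have hγ : γ < rk R v := h ▸ Order.lt_succ γ
      obtain ⟨u, hu, rfl⟩ := exists_rk_eq hR hv hγ
      rw [← h, T.succ _ (hγ.trans_le hlam)] at hA
      exact hlow u hu A (RedTo.trans hA (T.least _ (hγ.trans_le hlam) _ (hcov u hu)))
    · rw [T.limit _ hlam h] at hA
      simp only [Set.mem_iUnion] at hA
      obtain ⟨γ, hγ, hA⟩ := hA
      obtain ⟨u, hu, rfl⟩ := exists_rk_eq hR hv hγ
      exact hlow u hu A ((hcov u hu).redTo hA)

theorem exists_row_eq (T : IsTower lam B D P) (hR : ∀ a b c, R a b → R b c → R a c)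
    (hv : Acc R v) (hlam : rk R v ≤ lam) {A : Set ℕ} (hA : A ∈ D (rk R v)) :
    ∃ n, A = row (hier R B) (pair v n) := by
  obtain ⟨n, hn⟩ := T.arithAt_of_mem hR hv hlam hA
  refine ⟨n, ?_⟩
  ext x
  simpa using hn () x

/-- The part of the hierarchy up to a node of rank `α` belongs to `D (α + 1)`. -/
theorem hier_mem (T : IsTower lam B D P) (hR : ∀ a b c, R a b → R b c → R a c)
    (hRB : ArithIn B fun a : ℕ × ℕ => R a.1 a.2) (hv : Acc R v) (hlam : rk R v < lam) (n : ℕ) :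
    solutionUpTo (lex R) (step R B) (pair v n) ∈ D (Order.succ (rk R v)) := by
  have := T.solutionUpTo_mem (r := lex R) (Φ := step R B) (isLocal_step R B) (lex_trans hR)
    (arithOp_step hRB) (arithIn_lex hRB)
    (W := fun p => Acc R p.unpair.1 ∧ rk R p.unpair.1 < lam) (fun p hp => acc_lex hp.1) ?_
    (lev := fun p => rk R p.unpair.1) (fun p hp => hp.2) ?_ ?_ (p := pair v n) (by simp [hv, hlam])
  · simpa using this
  · rintro p q ⟨hp, hp'⟩ (h | ⟨h, -⟩)
    · exact ⟨hp.inv h, (rk_lt hp h).trans hp'⟩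
    · rw [h]
      exact ⟨hp, hp'⟩
  · rintro p q ⟨hp, hp'⟩ (h | ⟨h, -⟩)
    · exact (rk_lt hp h).le
    · rw [h]
  · rintro p ⟨hp, -⟩
    refine ((Set.finite_Iio p.unpair.2).image (pair p.unpair.1)).subset ?_
    rintro q ⟨h | ⟨h, h'⟩, hq⟩
    · exact absurd hq (rk_lt hp h).ne
    · exact ⟨q.unpair.2, h', by rw [← h, Nat.pair_unpair]⟩

theorem row_hier_mem (T : IsTower lam B D P) (hR : ∀ a b c, R a b → R b c → R a c)
    (hRB : ArithIn B fun a : ℕ × ℕ => R a.1 a.2) (hv : Acc R v) (hlam : rk R v < lam) (n : ℕ) :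
    row (hier R B) (pair v n) ∈ D (Order.succ (rk R v)) := by
  refine (T.isIdeal (Order.succ_le_of_lt hlam)).mem_of_redTo _ (T.hier_mem hR hRB hv hlam n) _ ?_
  exact redTo_row (n := pair v n) (row_solutionUpTo (.inl rfl)).symm

/-- The ordinal `α` is the rank of a point in a transitive relation that is arithmetical in `B`. -/
def _root_.TarskiHierarchy.IsCoded (B : Set ℕ) (α : Ordinal.{0}) : Prop :=
  ∃ R : ℕ → ℕ → Prop, (∀ a b c, R a b → R b c → R a c) ∧
    (ArithIn B fun a : ℕ × ℕ => R a.1 a.2) ∧ ∃ v, Acc R v ∧ rk R v = α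

/-- The rows below a node of rank `α` enumerate `D α`, for limit `α`, and can be recovered from
every set that covers `D α`. -/
theorem exists_enumerates_of_isCoded (T : IsTower lam B D P) {α : Ordinal} (hα : IsCoded B α)
    (hlam : α ≤ lam) (hlim : Order.IsSuccLimit α) :
    ∃ Q, Enumerates (D α) Q ∧ ∀ P', Covers (D α) P' → RedTo Q P' := by
  obtain ⟨R, hR, hRB, v, hv, rfl⟩ := hα
  have hD : ∀ A, A ∈ D (rk R v) ↔ ∃ γ < rk R v, A ∈ D γ := fun A => by
    rw [T.limit _ hlam hlim]; simp
  have hlt : ∀ u, R u v → rk R u < lam := fun u hu => (rk_lt hv hu).trans_le hlam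
  have hsucc : ∀ u, R u v → D (Order.succ (rk R u)) ⊆ D (rk R v) := fun u hu =>
    T.mono (Order.succ_le_of_lt (rk_lt hv hu)) hlam
  refine ⟨{t | R t.unpair.1.unpair.1 v ∧ t ∈ hier R B}, ?_, fun P' hP' => ?_⟩
  · ext A
    constructor
    · intro hA
      obtain ⟨γ, hγ, hA⟩ := (hD A).1 hA
      obtain ⟨u, hu, rfl⟩ := exists_rk_eq hR hv hγ
      obtain ⟨n, rfl⟩ := T.exists_row_eq hR (hv.inv hu) (hlt u hu).le hA
      refine ⟨pair u n, ?_⟩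
      ext x
      simp [hu]
    · rintro ⟨p, rfl⟩
      by_cases hu : R p.unpair.1 v
      · have := hsucc _ hu (T.row_hier_mem hR hRB (hv.inv hu) (hlt _ hu) p.unpair.2)
        convert this using 1
        ext x
        simp [hu]
      · refine (T.isIdeal hlam).mem_of_arithIn (T.oracle_mem hlam) ((Arith.lt (f := fun x : ℕ => x)
          (g := fun x => x) (by fun_prop) (by fun_prop)).of_iff fun _ x => ?_)
        simp [hu]
  · have hBP : RedTo B P' := hP'.redTo (T.oracle_mem hlam)
    refine redTo_solution_of_covers (S := fun p => R p.unpair.1 v) (isLocal_step R B) (lex_trans hR)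
      (arithOp_step hRB) (arithIn_lex hRB) hP' (fun p hp => ⟨acc_lex (hv.inv hp), ?_⟩) (.refl P')
      hBP ((hRB.of_redTo hBP).comp (f := fun p : ℕ => (p.unpair.1, v)) (by fun_prop))
    have := hsucc _ hp (T.hier_mem hR hRB (hv.inv hp) (hlt _ hp) p.unpair.2)
    rwa [Nat.pair_unpair] at this

end IsTower

/-! ### Ranks of relations that are arithmetical in the oracle -/

section Coded

variable {B : Set ℕ} {α β : Ordinal.{0}}

theorem IsCoded.of_le (h : IsCoded B β) (hα : α ≤ β) : IsCoded B α := by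
  obtain ⟨R, hR, hRB, v, hv, rfl⟩ := h
  rcases hα.eq_or_lt with rfl | hα
  · exact ⟨R, hR, hRB, v, hv, rfl⟩
  · obtain ⟨u, hu, rfl⟩ := exists_rk_eq hR hv hα
    exact ⟨R, hR, hRB, u, hv.inv hu, rfl⟩

theorem isCoded_zero (B : Set ℕ) : IsCoded B 0 := by
  refine ⟨fun _ _ => False, fun _ _ _ h _ => h, ?_, 0, acc_false 0, ?_⟩
  · exact (Arith.lt (f := fun a : ℕ × ℕ => a.1) (g := fun a => a.1) (by fun_prop)
      (by fun_prop)).of_iff (by simp)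
  · by_contra h
    obtain ⟨u, hu, -⟩ := exists_rk_eq (fun _ _ _ h _ => h) (acc_false 0) (pos_iff_ne_zero.2 h)
    exact hu

theorem rk_le_of_hom {R S : ℕ → ℕ → Prop} (hR : ∀ a b c, R a b → R b c → R a c) (f : ℕ → ℕ)
    (hf : ∀ a b, R a b → S (f a) (f b)) {v : ℕ} (hv : Acc R v) (hv' : Acc S (f v)) :
    rk R v ≤ rk S (f v) := by
  induction hv with
  | intro v hv ih =>
    refine le_of_forall_lt fun o ho => ?_
    obtain ⟨u, hu, rfl⟩ := exists_rk_eq hR ⟨v, hv⟩ ho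
    exact (ih u hu (hv'.inv (hf _ _ hu))).trans_lt (rk_lt hv' (hf _ _ hu))

theorem IsCoded.succ (h : IsCoded B α) : IsCoded B (Order.succ α) := by
  obtain ⟨R, hR, hRB, v, hv, rfl⟩ := h
  have hacc : ∀ n, Acc (lex R) (pair v n) := fun n => acc_lex (by simpa using hv)
  refine IsCoded.of_le ⟨lex R, lex_trans hR, arithIn_lex hRB, pair v 1, hacc 1, rfl⟩
    (Order.succ_le_of_lt ?_)
  refine (rk_le_of_hom hR (S := lex R) (fun u => pair u 0) (fun a b h => .inl (by simpa)) hv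
    (hacc 0)).trans_lt (rk_lt (hacc 1) (.inr (by simp)))

theorem isSuccLimit_of_isCoded (h : ∀ β < α, IsCoded B β) (hα : ¬ IsCoded B α) :
    Order.IsSuccLimit α := by
  rcases Ordinal.zero_or_succ_or_isSuccLimit α with rfl | ⟨γ, rfl⟩ | h'
  · exact absurd (isCoded_zero B) hα
  · exact absurd (h γ (Order.lt_succ γ)).succ hα
  · exact h'

end Coded

/-! ### Comparison of ranks -/

/-- One step of the comparison of the ranks in `S` with the ranks in `U`. -/
def compareStep (S U : ℕ → ℕ → Prop) (X : Set ℕ) (u s : ℕ) : Prop :=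
  ∀ s', S s' s → ∃ u', U u' u ∧ pair u' s' ∈ X

section Compare

variable {S U : ℕ → ℕ → Prop} {B : Set ℕ}

theorem isLocal_compareStep : IsLocal U (compareStep S U) := by
  intro X Y p x h
  refine forall_congr' fun s => imp_congr_right fun _ => exists_congr fun u =>
    and_congr_right fun hu => ?_
  rw [← mem_row, h u hu, mem_row]

theorem arithOp_compareStep (hS : ArithIn B fun a : ℕ × ℕ => S a.1 a.2)
    (hU : ArithIn B fun a : ℕ × ℕ => U a.1 a.2) : ArithOp B (compareStep S U) := by
  intro P C hP hB
  refine .all (.imp ?_ (.ex (.and ?_ ?_)))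
  · exact (hS.of_redTo hB).comp (f := fun x : (ℕ × ℕ × ℕ) × ℕ => (x.2, x.1.2.2)) (by fun_prop)
  · exact (hU.of_redTo hB).comp (f := fun x : ((ℕ × ℕ × ℕ) × ℕ) × ℕ => (x.2, x.1.1.2.1))
      (by fun_prop)
  · exact Arith.mem' hP (f := fun x : ((ℕ × ℕ × ℕ) × ℕ) × ℕ => pair x.1.1.1 (pair x.2 x.1.2))
      (by fun_prop)

theorem not_compare_of_not_acc {u : ℕ} (hu : Acc U u) {s : ℕ} (hs : ¬ Acc S s) :
    pair u s ∉ solution U (compareStep S U) := by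
  induction hu generalizing s with
  | intro u hu ih =>
    rw [mem_solution isLocal_compareStep ⟨u, hu⟩]
    intro h
    obtain ⟨s', hs', hss'⟩ : ∃ s', ¬ Acc S s' ∧ S s' s := by
      by_contra! h'
      exact hs ⟨s, fun s' hss' => by_contra fun h'' => h' s' h'' hss'⟩
    obtain ⟨u', huu', hu'⟩ := h s' hss'
    exact ih u' huu' hs' hu'

theorem compare_of_rk_le (hU : ∀ a b c, U a b → U b c → U a c) {u : ℕ} (hu : Acc U u) {s : ℕ}
    (hs : Acc S s) (h : rk S s ≤ rk U u) : pair u s ∈ solution U (compareStep S U) := by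
  induction hs generalizing u with
  | intro s hs ih =>
    rw [mem_solution isLocal_compareStep hu]
    intro s' hs'
    obtain ⟨u', hu', h'⟩ := exists_rk_eq hU hu ((rk_lt ⟨s, hs⟩ hs').trans_le h)
    exact ⟨u', hu', ih s' hs' (hu.inv hu') h'.ge⟩

theorem IsTower.compare_mem {lam : Ordinal.{0}} {D : Ordinal.{0} → Set (Set ℕ)}
    {P : Ordinal.{0} → Set ℕ} (T : IsTower lam B D P) (hU : ∀ a b c, U a b → U b c → U a c)
    (hSB : ArithIn B fun a : ℕ × ℕ => S a.1 a.2) (hUB : ArithIn B fun a : ℕ × ℕ => U a.1 a.2)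
    {u : ℕ} (hu : Acc U u) (hlam : rk U u < lam) :
    solutionUpTo U (compareStep S U) u ∈ D (Order.succ (rk U u)) := by
  refine T.solutionUpTo_mem isLocal_compareStep hU (arithOp_compareStep hSB hUB) hUB
    (W := fun p => Acc U p ∧ rk U p < lam) (fun p hp => hp.1)
    (fun p q hp hq => ⟨hp.1.inv hq, (rk_lt hp.1 hq).trans hp.2⟩) (fun p hp => hp.2)
    (fun p q hp hq => (rk_lt hp.1 hq).le) (fun p hp => ?_) ⟨hu, hlam⟩
  convert Set.finite_empty
  ext q
  simp only [Set.mem_ofPred_eq, Set.mem_empty_iff_false, iff_false, not_and]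
  exact fun h => (rk_lt hp.1 h).ne

end Compare

/-! ### Relations on coded objects -/

section Coding

variable {α : Type} [Primcodable α] {r : α → α → Prop}

/-- The relation on codes induced by a relation on coded objects. -/
def onCodes (r : α → α → Prop) (a b : ℕ) : Prop := ∃ p q, encode p = a ∧ encode q = b ∧ r p q

@[simp] theorem onCodes_encode {p q : α} : onCodes r (encode p) (encode q) ↔ r p q := by
  simp [onCodes]

theorem exists_of_onCodes {a : ℕ} {q : α} (h : onCodes r a (encode q)) :
    ∃ p, encode p = a ∧ r p q := by
  obtain ⟨p, q', hp, hq, h⟩ := h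
  rw [encode_inj] at hq
  exact ⟨p, hp, hq ▸ h⟩

theorem onCodes_trans (hr : ∀ a b c, r a b → r b c → r a c) (a b c : ℕ) (h : onCodes r a b)
    (h' : onCodes r b c) : onCodes r a c := by
  obtain ⟨p, q, rfl, rfl, h⟩ := h
  obtain ⟨q', s, hq, rfl, h'⟩ := h'
  rw [encode_inj] at hq
  subst hq
  exact onCodes_encode.2 (hr _ _ _ h h')

theorem acc_onCodes {p : α} : Acc (onCodes r) (encode p) ↔ Acc r p := by
  constructor
  · intro h
    generalize ha : encode p = a at h
    induction h generalizing p with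
    | intro a _ ih => exact ⟨p, fun q hq => ih (encode q) (ha ▸ onCodes_encode.2 hq) rfl⟩
  · intro h
    induction h with
    | intro p _ ih =>
      refine ⟨_, fun a ha => ?_⟩
      obtain ⟨q, rfl, hq⟩ := exists_of_onCodes ha
      exact ih q hq

theorem arithIn_onCodes {B : Set ℕ} (h : ArithIn B fun a : α × α => r a.1 a.2) :
    ArithIn B fun a : ℕ × ℕ => onCodes r a.1 a.2 := by
  refine .ex (.ex (.and (.eq (by fun_prop) (by fun_prop)) (.and
    (.eq (by fun_prop) (by fun_prop)) ?_)))
  exact h.comp (f := fun a : ((ℕ × ℕ) × α) × α => (a.1.2, a.2)) (by fun_prop)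

end Coding

/-! ### Branches of trees -/

/-- The sequence of the first `n` values of `g`. -/
def initial (g : ℕ → ℕ) (n : ℕ) : List ℕ := (List.range n).map g

/-- `g` is a branch of the tree `T`. -/
def IsBranch (T : List ℕ → Prop) (g : ℕ → ℕ) : Prop := ∀ n, T (initial g n)

/-- The sequence `s` is a proper extension of `t`. -/
def Extends (s t : List ℕ) : Prop := t.length < s.length ∧ s.take t.length = t

theorem length_initial (g : ℕ → ℕ) (n : ℕ) : (initial g n).length = n := by simp [initial]

theorem getD_initial (g : ℕ → ℕ) {n k : ℕ} (h : k < n) : (initial g n).getD k 0 = g k := by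
  simp [initial, h]

theorem take_initial (g : ℕ → ℕ) {n k : ℕ} (h : k ≤ n) :
    (initial g n).take k = initial g k := by
  rw [initial, ← List.map_take, List.take_range, min_eq_left h, initial]

theorem extends_initial (g : ℕ → ℕ) {n k : ℕ} (h : k < n) :
    Extends (initial g n) (initial g k) := by
  simp [Extends, length_initial, h, take_initial g h.le]

theorem initial_congr {g g' : ℕ → ℕ} {n : ℕ} (h : ∀ k < n, g k = g' k) :
    initial g n = initial g' n :=
  List.map_congr_left fun k hk => h k (List.mem_range.1 hk)

theorem Extends.trans {s t u : List ℕ} (h : Extends s t) (h' : Extends t u) : Extends s u := by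
  refine ⟨h'.1.trans h.1, ?_⟩
  calc s.take u.length = (s.take t.length).take u.length := by
        rw [List.take_take, min_eq_left h'.1.le]
    _ = u := by rw [h.2, h'.2]

theorem Extends.getD {s t : List ℕ} (h : Extends s t) {k : ℕ} (hk : k < t.length) :
    s.getD k 0 = t.getD k 0 := by
  rw [← h.2]
  simp [hk]

/-- An increasing sequence of finite sequences has a limit. -/
theorem exists_limit {f : ℕ → List ℕ} (hf : ∀ n, Extends (f (n + 1)) (f n)) :
    ∃ g : ℕ → ℕ, ∀ n k, k ≤ (f n).length → (f n).take k = initial g k := by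
  have hlen : ∀ n, n ≤ (f n).length := fun n => by
    induction n with
    | zero => exact Nat.zero_le _
    | succ n ih => exact Nat.succ_le_of_lt (ih.trans_lt (hf n).1)
  have hext : ∀ m n, m < n → Extends (f n) (f m) := fun m n h => by
    induction n, h using Nat.le_induction with
    | base => exact hf m
    | succ n _ ih => exact (hf n).trans ih
  have hget : ∀ m n k, k < (f m).length → k < (f n).length → (f m).getD k 0 = (f n).getD k 0 := by
    intro m n k hm hn
    rcases lt_trichotomy m n with h | rfl | h
    · exact ((hext m n h).getD hm).symm
    · rfl
    · exact (hext n m h).getD hn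
  refine ⟨fun k => (f (k + 1)).getD k 0, fun n k hk => ?_⟩
  refine List.ext_getElem (by simp [length_initial, hk]) fun i hi hi' => ?_
  have hik : i < k := by simpa [length_initial] using hi'
  have := hget n (i + 1) i (hik.trans_le hk) (hlen (i + 1))
  simp only [List.getElem_take, initial, List.getElem_map, List.getElem_range]
  rw [← this, List.getD_eq_getElem _ _ (hik.trans_le hk)]

/-- Baire's category theorem for the space of branches of a tree: if every branch `g` computes
the set `A` by one of countably many rules, then one rule applies to all branches in a neighbourhood
of some branch. -/
theorem exists_uniform_rule {T : List ℕ → Prop} (hT : ∃ g, IsBranch T g) {A : Set ℕ}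
    {h : ℕ → ℕ → ℕ} (hA : ∀ g, IsBranch T g → ∃ n, ∀ x, x ∈ A ↔ g (h n x) ≠ 0) :
    ∃ n m g₀, IsBranch T g₀ ∧
      ∀ g, IsBranch T g → (∀ k < m, g k = g₀ k) → ∀ x, x ∈ A ↔ g (h n x) ≠ 0 := by
  by_contra! hcon
  -- a branch that refutes all rules is built from larger and larger pieces of branches
  have step : ∀ (n : ℕ) (c : {g : ℕ → ℕ // IsBranch T g} × ℕ),
      ∃ c' : {g : ℕ → ℕ // IsBranch T g} × ℕ, c.2 < c'.2 ∧
        (∀ k < c.2, c'.1.1 k = c.1.1 k) ∧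
        ∃ x, h n x < c'.2 ∧ ¬ (x ∈ A ↔ c'.1.1 (h n x) ≠ 0) := by
    rintro n ⟨⟨g, hg⟩, m⟩
    obtain ⟨g', hg', hgg', x, hx⟩ := hcon n m g hg
    refine ⟨⟨⟨g', hg'⟩, m + h n x + 1⟩, ?_, hgg', x, ?_, ?_⟩
    · simp only; omega
    · simp only; omega
    · simp only; tauto
  choose F hF₁ hF₂ hF₃ using step
  obtain ⟨g₁, hg₁⟩ := hT
  let c : ℕ → {g : ℕ → ℕ // IsBranch T g} × ℕ :=
    fun n => Nat.rec (⟨g₁, hg₁⟩, 0) (fun n c => F n c) n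
  have hc : ∀ n, c (n + 1) = F n (c n) := fun n => rfl
  have hmono : StrictMono fun n => (c n).2 := strictMono_nat_of_lt_succ fun n => by
    simp only [hc]; exact hF₁ n (c n)
  have hagree : ∀ m n, m ≤ n → ∀ k < (c m).2, (c n).1.1 k = (c m).1.1 k := by
    intro m n hmn k hk
    induction n, hmn using Nat.le_induction with
    | base => rfl
    | succ n hmn ih =>
      rw [hc, hF₂ n (c n) k (hk.trans_le (hmono.monotone hmn)), ih]
  let g : ℕ → ℕ := fun k => (c (k + 1)).1.1 k
  have hg : ∀ n, ∀ k < (c n).2, g k = (c n).1.1 k := by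
    intro n k hk
    have hk' : k < (c (k + 1)).2 := (Nat.lt_succ_self k).trans_le (hmono.id_le (k + 1))
    rcases le_total n (k + 1) with h | h
    · exact hagree _ _ h k hk
    · exact (hagree _ _ h k hk').symm
  have hgT : IsBranch T g := fun n => by
    have : initial g n = initial (c n).1.1 n :=
      initial_congr fun k hk => hg n k (hk.trans_le (hmono.id_le n))
    rw [this]
    exact (c n).1.2 n
  obtain ⟨n, hn⟩ := hA g hgT
  obtain ⟨x, hx, hx'⟩ := hF₃ n (c n)
  rw [← hc] at hx hx'
  exact hx' (by rw [← hg (n + 1) _ hx]; exact hn x)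

/-! ### Sets decided by the branches of a tree -/

/-- The finite sequence `t` may be extended to a branch `g` of `T` that agrees with the first `m`
values of `g₀` and for which `g (h x)` is zero if and only if `b` is, as far as this can be seen
from `t`. -/
def Node (T : List ℕ → Prop) (g₀ : ℕ → ℕ) (m : ℕ) (h : ℕ → ℕ) (b x : ℕ) (t : List ℕ) : Prop :=
  (∀ k, k ≤ t.length → T (t.take k)) ∧
    (∀ k, k < m → k < t.length → t.getD k 0 = (initial g₀ m).getD k 0) ∧
    (h x < t.length → (t.getD (h x) 0 = 0 ↔ b = 0))

/-- The extension of nodes, for all `x` separately. -/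
def nodeRel (T : List ℕ → Prop) (g₀ : ℕ → ℕ) (m : ℕ) (h : ℕ → ℕ) (b : ℕ) (p q : ℕ × List ℕ) :
    Prop :=
  p.1 = q.1 ∧ Extends p.2 q.2 ∧ Node T g₀ m h b p.1 p.2

/-- The simultaneous extension of a node for `0` and a node for `1`, with a top element `none`. -/
def pairRel (T : List ℕ → Prop) (g₀ : ℕ → ℕ) (m : ℕ) (h : ℕ → ℕ)
    (p q : Option (ℕ × List ℕ × List ℕ)) : Prop :=
  ∃ a, p = some a ∧ (q = none ∨ ∃ c, q = some c ∧ nodeRel T g₀ m h 0 (a.1, a.2.1) (c.1, c.2.1) ∧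
    nodeRel T g₀ m h 1 (a.1, a.2.2) (c.1, c.2.2))

section Tree

variable {T : List ℕ → Prop} {g₀ : ℕ → ℕ} {m : ℕ} {h : ℕ → ℕ} {b : ℕ} {B : Set ℕ}

theorem nodeRel_trans (p q s : ℕ × List ℕ) (hpq : nodeRel T g₀ m h b p q)
    (hqs : nodeRel T g₀ m h b q s) : nodeRel T g₀ m h b p s :=
  ⟨hpq.1.trans hqs.1, hpq.2.1.trans hqs.2.1, hpq.2.2⟩

theorem pairRel_trans (p q s : Option (ℕ × List ℕ × List ℕ)) (hpq : pairRel T g₀ m h p q)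
    (hqs : pairRel T g₀ m h q s) : pairRel T g₀ m h p s := by
  obtain ⟨a, rfl, hq⟩ := hpq
  obtain ⟨c, rfl, hs⟩ := hqs
  refine ⟨a, rfl, hs.imp_right ?_⟩
  rintro ⟨e, rfl, h₀, h₁⟩
  rcases hq with hq | ⟨c', hc', h₀', h₁'⟩
  · simp at hq
  · obtain rfl := Option.some.inj hc'
    exact ⟨e, rfl, nodeRel_trans _ _ _ h₀' h₀, nodeRel_trans _ _ _ h₁' h₁⟩

theorem arithIn_nodeRel (hT : ArithIn B T) (hh : Primrec h) :
    ArithIn B fun a : (ℕ × List ℕ) × ℕ × List ℕ => nodeRel T g₀ m h b a.1 a.2 := by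
  refine .and (.eq (by fun_prop) (by fun_prop)) (.and (.and (.lt (by fun_prop) (by fun_prop))
    (.eq (by fun_prop) (by fun_prop))) (.and (.all (.imp (.le (by fun_prop) (by fun_prop)) ?_))
    (.and (.all (.imp (.lt (by fun_prop) (by fun_prop)) (.imp (.lt (by fun_prop) (by fun_prop))
    (.eq (by fun_prop) (by fun_prop))))) (.imp (.lt (by fun_prop) (by fun_prop))
    (.iff (.eq (by fun_prop) (by fun_prop)) (.eq (by fun_prop) (by fun_prop)))))))
  exact hT.comp (f := fun a : ((ℕ × List ℕ) × ℕ × List ℕ) × ℕ => a.1.1.2.take a.2) (by fun_prop)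

theorem arithIn_pairRel (hT : ArithIn B T) (hh : Primrec h) :
    ArithIn B fun a : Option (ℕ × List ℕ × List ℕ) × Option (ℕ × List ℕ × List ℕ) =>
      pairRel T g₀ m h a.1 a.2 := by
  refine .ex (.and (.eq (by fun_prop) (by fun_prop)) (.or (.eq (by fun_prop) (by fun_prop))
    (.ex (.and (.eq (by fun_prop) (by fun_prop)) (.and ?_ ?_)))))
  · exact (arithIn_nodeRel hT hh).comp (f := fun a : ((Option (ℕ × List ℕ × List ℕ) ×
      Option (ℕ × List ℕ × List ℕ)) × ℕ × List ℕ × List ℕ) × ℕ × List ℕ × List ℕ =>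
      ((a.1.2.1, a.1.2.2.1), (a.2.1, a.2.2.1))) (by fun_prop)
  · exact (arithIn_nodeRel hT hh).comp (f := fun a : ((Option (ℕ × List ℕ × List ℕ) ×
      Option (ℕ × List ℕ × List ℕ)) × ℕ × List ℕ × List ℕ) × ℕ × List ℕ × List ℕ =>
      ((a.1.2.1, a.1.2.2.2), (a.2.1, a.2.2.2))) (by fun_prop)

theorem node_initial {g : ℕ → ℕ} (hg : IsBranch T g) (hgm : ∀ k < m, g k = g₀ k) {x : ℕ}
    (hb : g (h x) = 0 ↔ b = 0) (n : ℕ) : Node T g₀ m h b x (initial g n) := by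
  simp only [Node, length_initial]
  refine ⟨fun k hk => ?_, fun k hk hk' => ?_, fun hk => ?_⟩
  · rw [take_initial g hk]
    exact hg k
  · rw [getD_initial g hk', getD_initial g₀ hk, hgm k hk]
  · rw [getD_initial g hk, hb]

/-- An infinite chain of nodes yields a branch. -/
theorem exists_branch_of_chain {f : ℕ → List ℕ} {x : ℕ} (hf : ∀ n, Extends (f (n + 1)) (f n))
    (hN : ∀ n, Node T g₀ m h b x (f n)) :
    ∃ g, IsBranch T g ∧ (∀ k < m, g k = g₀ k) ∧ (g (h x) = 0 ↔ b = 0) := by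
  obtain ⟨g, hg⟩ := exists_limit hf
  have hlen : ∀ n, n ≤ (f n).length := fun n => by
    induction n with
    | zero => exact Nat.zero_le _
    | succ n ih => exact Nat.succ_le_of_lt (ih.trans_lt (hf n).1)
  have hget : ∀ k, k < (f (k + 1)).length ∧ (f (k + 1)).getD k 0 = g k := fun k => by
    have hk : k < (f (k + 1)).length := hlen (k + 1)
    refine ⟨hk, ?_⟩
    have := hg (k + 1) (f (k + 1)).length le_rfl
    rw [List.take_length] at this
    rw [this, getD_initial g hk]
  refine ⟨g, fun n => ?_, fun k hk => ?_, ?_⟩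
  · rw [← hg n n (hlen n)]
    exact (hN n).1 n (hlen n)
  · rw [← (hget k).2, (hN (k + 1)).2.1 k hk (hget k).1, getD_initial g₀ hk]
  · rw [← (hget (h x)).2]
    exact (hN (h x + 1)).2.2 (hget (h x)).1

/-- If the branches of `T` near `g₀` decide membership in a set, then nodes for both answers cannot
be extended indefinitely. -/
theorem acc_pairRel {A : Set ℕ}
    (hA : ∀ g, IsBranch T g → (∀ k < m, g k = g₀ k) → ∀ x, x ∈ A ↔ g (h x) ≠ 0) :
    ∀ p, Acc (pairRel T g₀ m h) p := by
  intro p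
  by_contra hp
  obtain ⟨f, -, hf⟩ := not_acc_iff_exists_descending_chain.1 hp
  choose a ha hf' using hf
  have hrel : ∀ n, nodeRel T g₀ m h 0 ((a (n + 1)).1, (a (n + 1)).2.1) ((a n).1, (a n).2.1) ∧
      nodeRel T g₀ m h 1 ((a (n + 1)).1, (a (n + 1)).2.2) ((a n).1, (a n).2.2) := fun n => by
    rcases hf' (n + 1) with h' | ⟨c, hc, h₀, h₁⟩
    · simp [ha] at h'
    · rw [ha n] at hc
      obtain rfl := Option.some.inj hc
      exact ⟨h₀, h₁⟩
  have hx : ∀ n, (a n).1 = (a 0).1 := fun n => by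
    induction n with
    | zero => rfl
    | succ n ih => exact (hrel n).1.1.trans ih
  obtain ⟨g, hg, hgm, hg'⟩ := exists_branch_of_chain (T := T) (g₀ := g₀) (m := m) (h := h) (b := 0)
    (x := (a 0).1) (f := fun n => (a (n + 1)).2.1) (fun n => (hrel (n + 1)).1.2.1)
    (fun n => hx (n + 1) ▸ (hrel n).1.2.2)
  obtain ⟨g', hg₁, hgm₁, hg₁'⟩ := exists_branch_of_chain (T := T) (g₀ := g₀) (m := m) (h := h)
    (b := 1) (x := (a 0).1) (f := fun n => (a (n + 1)).2.2) (fun n => (hrel (n + 1)).2.2.1)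
    (fun n => hx (n + 1) ▸ (hrel n).2.2.2)
  have h₀ := hA g hg hgm (a 0).1
  have h₁ := hA g' hg₁ hgm₁ (a 0).1
  simp only [iff_true, one_ne_zero, iff_false] at hg' hg₁'
  tauto

/-- A set that is decided, by a fixed bit, by all branches of an arithmetical tree near a given
branch belongs to the tower below the first ordinal that is not coded. The recursion compares, for
each `x`, the tree of the nodes for the answer `0` with the well-founded tree of the pairs of nodes
for both answers; it succeeds precisely if there is no branch with the answer `0`. -/
theorem IsTower.mem_of_branches {lam κ : Ordinal.{0}} {D : Ordinal.{0} → Set (Set ℕ)}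
    {P : Ordinal.{0} → Set ℕ} (tower : IsTower lam B D P) (hκ : κ ≤ lam)
    (hcod : ∀ β, IsCoded B β → β < κ) (hT : ArithIn B T)
    (hh : Primrec h) (hg₀ : IsBranch T g₀) {A : Set ℕ}
    (hA : ∀ g, IsBranch T g → (∀ k < m, g k = g₀ k) → ∀ x, x ∈ A ↔ g (h x) ≠ 0) : A ∈ D κ := by
  set U := onCodes (pairRel T g₀ m h) with hU
  set S := onCodes (nodeRel T g₀ m h 0) with hS
  have hUtrans : ∀ a b c, U a b → U b c → U a c := onCodes_trans pairRel_trans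
  have hUB : ArithIn B fun a : ℕ × ℕ => U a.1 a.2 := arithIn_onCodes (arithIn_pairRel hT hh)
  have hSB : ArithIn B fun a : ℕ × ℕ => S a.1 a.2 := arithIn_onCodes (arithIn_nodeRel hT hh)
  have hacc : ∀ p : Option (ℕ × List ℕ × List ℕ), Acc U (encode p) := fun p =>
    acc_onCodes.2 (acc_pairRel hA p)
  set top : ℕ := encode (none : Option (ℕ × List ℕ × List ℕ)) with htop
  have hrk : rk U top < κ := hcod _ ⟨U, hUtrans, hUB, top, hacc _, rfl⟩
  have hmem := tower.mono (Order.succ_le_of_lt hrk) hκ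
    (tower.compare_mem hUtrans hSB hUB (hacc _) (hrk.trans_le hκ))
  have hpos : ∀ x ∈ A, ∀ p : Option (ℕ × List ℕ × List ℕ), ∀ t,
      p = some (x, t, initial g₀ t.length) →
      pair (encode p) (encode (x, t)) ∈ solution U (compareStep S U) := by
    intro x hx p
    have hp := acc_pairRel hA p
    induction hp with
    | intro p _ ih =>
      rintro t rfl
      rw [mem_solution isLocal_compareStep (hacc _)]
      intro s' hs'
      obtain ⟨⟨y, t'⟩, rfl, rfl, hext, hN⟩ := exists_of_onCodes hs'
      have hrel : pairRel T g₀ m h (some (y, t', initial g₀ t'.length))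
          (some (y, t, initial g₀ t.length)) := by
        refine ⟨_, rfl, .inr ⟨_, rfl, ⟨rfl, hext, hN⟩, rfl, extends_initial g₀ hext.1, ?_⟩⟩
        refine node_initial hg₀ (fun _ _ => rfl) ?_ _
        simpa using (hA g₀ hg₀ (fun _ _ => rfl) y).1 hx
      exact ⟨_, onCodes_encode.2 hrel, ih _ hrel t' rfl⟩
  have hneg : ∀ x, x ∉ A → ¬ Acc S (encode (x, ([] : List ℕ))) := by
    intro x hx
    rw [hS, acc_onCodes, not_acc_iff_exists_descending_chain]
    refine ⟨fun n => (x, initial g₀ n), rfl, fun n => ⟨rfl, extends_initial g₀ n.lt_succ_self, ?_⟩⟩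
    refine node_initial hg₀ (fun _ _ => rfl) ?_ _
    simpa using (not_congr (hA g₀ hg₀ (fun _ _ => rfl) x)).1 hx
  refine (tower.isIdeal hκ).mem_of_arithIn hmem ((Arith.mem (f := fun x : ℕ =>
    pair (encode (some (x, ([] : List ℕ), ([] : List ℕ)))) (encode (x, ([] : List ℕ))))
    (by fun_prop)).of_iff fun _ x => ?_)
  have hlt : U (encode (some (x, ([] : List ℕ), ([] : List ℕ)))) top :=
    onCodes_encode.2 ⟨_, rfl, .inl rfl⟩
  simp only [solutionUpTo, Set.mem_ofPred_eq, Nat.unpair_pair, hlt, or_true, true_and]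
  constructor
  · exact fun hx => hpos x hx _ [] rfl
  · intro h'
    by_contra hx
    exact not_compare_of_not_acc (hacc _) (hneg x hx) h'

end Tree

/-! ### Rich sets -/

/-- The relation with index `e`, relative to the truth set `Z` of the oracle. -/
def indexed (Z : Set ℕ) (e a b : ℕ) : Prop := pair (pair 0 e) (pair a b) ∈ Z

theorem exists_indexed {B : Set ℕ} {R : ℕ → ℕ → Prop} (hR : ArithIn B fun a : ℕ × ℕ => R a.1 a.2) :
    ∃ e, R = indexed (hier (fun _ _ => False) B) e := by
  obtain ⟨e, he⟩ := hR
  refine ⟨e, ?_⟩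
  ext a b
  simpa [indexed] using he () (a, b)

theorem arithIn_indexed (B : Set ℕ) (e : ℕ) :
    ArithIn B fun a : ℕ × ℕ => indexed (hier (fun _ _ => False) B) e a.1 a.2 :=
  ⟨e, fun _ ⟨a, b⟩ => by simp [indexed]⟩

/-- The set `G` contains, as a row, the truth set of `B` and, for every transitive relation that is
arithmetical in `B` and every node, either the hierarchy up to this node or a witness that the node
is not accessible. This is an arithmetical property of `G`, although accessibility is not. -/
def IsRich (B G : Set ℕ) : Prop :=
  (∀ p x, pair p x ∈ row G 0 ↔ step (fun _ _ => False) B (row G 0) p x) ∧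
    ∀ e v, (∀ a b c, indexed (row G 0) e a b → indexed (row G 0) e b c →
      indexed (row G 0) e a c) →
      (∃ i, v ∈ row G i ∧ ∀ a, a ∈ row G i → ∃ b, b ∈ row G i ∧ indexed (row G 0) e b a) ∨
      ∃ i, ∀ n, IsApprox (lex (indexed (row G 0) e)) (step (indexed (row G 0) e) B) (pair v n)
        (row G i)

theorem arith_isRich (B : Set ℕ) :
    Arith (fun G : Set ℕ => join B G) fun G (_ : Unit) => IsRich B G := by
  have hB : Arith (fun G : Set ℕ => join B G) fun _ x => x ∈ B :=
    arith_join_left (fun _ => B) fun G => G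
  have hG : Arith (fun G : Set ℕ => join B G) fun G x => x ∈ G :=
    arith_join_right (fun _ => B) fun G => G
  have hind : Arith (fun G : Set ℕ => join B G) fun G (a : ℕ × ℕ × ℕ) =>
      indexed (row G 0) a.1 a.2.1 a.2.2 :=
    Arith.mem' hG (f := fun a : ℕ × ℕ × ℕ => pair 0 (pair (pair 0 a.1) (pair a.2.1 a.2.2)))
      (by fun_prop)
  refine .and (.all (.all (.iff ?_ ?_))) (.all (.all (.imp (.all (.all (.all (.imp ?_
    (.imp ?_ ?_))))) (.or (.ex (.and ?_ (.all (.imp ?_ (.ex (.and ?_ ?_)))))) (.ex (.all ?_))))))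
  · exact Arith.mem' hG (f := fun a : (Unit × ℕ) × ℕ => pair 0 (pair a.1.2 a.2)) (by fun_prop)
  · refine Arith.step (R := fun _ _ _ _ => False) (B := fun _ => B) (X := fun G _ => row G 0) ?_ hB
      (Arith.mem' hG (f := fun a : ((Unit × ℕ) × ℕ) × ℕ => pair 0 a.2) (by fun_prop)) (by fun_prop)
      (by fun_prop)
    exact (Arith.lt (f := fun a : ((Unit × ℕ) × ℕ) × ℕ × ℕ => a.2.1) (g := fun a => a.2.1)
      (by fun_prop) (by fun_prop)).of_iff (by simp)
  · exact hind.comp (f := fun a : ((((Unit × ℕ) × ℕ) × ℕ) × ℕ) × ℕ =>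
      (a.1.1.1.1.2, a.1.1.2, a.1.2)) (by fun_prop)
  · exact hind.comp (f := fun a : ((((Unit × ℕ) × ℕ) × ℕ) × ℕ) × ℕ =>
      (a.1.1.1.1.2, a.1.2, a.2)) (by fun_prop)
  · exact hind.comp (f := fun a : ((((Unit × ℕ) × ℕ) × ℕ) × ℕ) × ℕ =>
      (a.1.1.1.1.2, a.1.1.2, a.2)) (by fun_prop)
  · exact Arith.mem' hG (f := fun a : ((Unit × ℕ) × ℕ) × ℕ => pair a.2 a.1.2) (by fun_prop)
  · exact Arith.mem' hG (f := fun a : (((Unit × ℕ) × ℕ) × ℕ) × ℕ => pair a.1.2 a.2) (by fun_prop)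
  · exact Arith.mem' hG (f := fun a : ((((Unit × ℕ) × ℕ) × ℕ) × ℕ) × ℕ => pair a.1.1.2 a.2)
      (by fun_prop)
  · exact hind.comp (f := fun a : ((((Unit × ℕ) × ℕ) × ℕ) × ℕ) × ℕ =>
      (a.1.1.1.1.2, a.2, a.1.2)) (by fun_prop)
  · refine Arith.isApprox_step (R := fun G (a : (((Unit × ℕ) × ℕ) × ℕ) × ℕ) =>
      indexed (row G 0) a.1.1.1.2) (B := fun _ => B) (X := fun G a => row G a.1.2) ?_ hB ?_
      (by fun_prop)
    · exact hind.comp (f := fun a : ((((Unit × ℕ) × ℕ) × ℕ) × ℕ) × ℕ × ℕ =>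
        (a.1.1.1.1.2, a.2.1, a.2.2)) (by fun_prop)
    · exact Arith.mem' hG (f := fun a : ((((Unit × ℕ) × ℕ) × ℕ) × ℕ) × ℕ => pair a.1.1.2 a.2)
        (by fun_prop)

theorem exists_isRich (B : Set ℕ) : ∃ G, IsRich B G := by
  set Z := hier (fun _ _ => False) B with hZ
  let X : ℕ → ℕ → Set ℕ := fun e v =>
    {a | (Acc (indexed Z e) v ∧ a ∈ hier (indexed Z e) B) ∨
      (¬ Acc (indexed Z e) v ∧ ¬ Acc (indexed Z e) a)}
  let G : Set ℕ := {t | (t.unpair.1 = 0 ∧ t.unpair.2 ∈ Z) ∨ (t.unpair.1 ≠ 0 ∧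
    t.unpair.2 ∈ X (t.unpair.1 - 1).unpair.1 (t.unpair.1 - 1).unpair.2)}
  have hG₀ : row G 0 = Z := by
    ext t; simp [G]
  have hG : ∀ e v, row G (pair e v + 1) = X e v := fun e v => by
    ext t; simp [G]
  refine ⟨G, ?_, fun e v hR => ?_⟩
  · rw [hG₀]
    exact fun p x => mem_hier (acc_false _) x
  · rw [hG₀] at hR ⊢
    by_cases hv : Acc (indexed Z e) v
    · refine .inr ⟨pair e v + 1, fun n => ?_⟩
      have : X e v = hier (indexed Z e) B := by
        ext t; simp [X, hv]
      rw [hG, this]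
      exact isApprox_solution (isLocal_step _ _) (acc_lex (by simpa using hv))
    · refine .inl ⟨pair e v + 1, ?_⟩
      have hX : ∀ a, a ∈ X e v ↔ ¬ Acc (indexed Z e) a := fun a => by simp [X, hv]
      simp only [hG, hX]
      refine ⟨hv, fun a ha => ?_⟩
      by_contra! hcon
      exact ha ⟨a, fun b hb => by_contra fun h => hcon b h hb⟩

theorem IsRich.row_zero {B G : Set ℕ} (h : IsRich B G) :
    row G 0 = hier (fun _ _ => False) B := by
  ext t
  have := (IsApprox.row_eq (p := t.unpair.1) (isLocal_step (fun _ _ => False) B)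
    (lex_trans fun _ _ _ h _ => h) (fun q _ x => h.1 q x) (acc_lex (acc_false _)) (.inl rfl))
  simpa [hier] using Set.ext_iff.1 this t.unpair.2

/-- The hierarchies in a rich set together cover `D κ`, so that the least cover `P κ` of `D κ` is
arithmetical in the rich set. -/
theorem IsTower.redTo_of_isRich {lam κ : Ordinal.{0}} {B : Set ℕ} {D : Ordinal.{0} → Set (Set ℕ)}
    {P : Ordinal.{0} → Set ℕ} (T : IsTower lam B D P) (hκ : κ < lam)
    (hlim : Order.IsSuccLimit κ) (hcod : ∀ β < κ, IsCoded B β) {G : Set ℕ} (hG : IsRich B G) :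
    RedTo (P κ) G := by
  have hcov : Covers (D κ) {s | pair s.unpair.1.unpair.1 (pair s.unpair.1.unpair.2 s.unpair.2)
      ∈ G} := by
    intro A hA
    rw [T.limit κ hκ.le hlim] at hA
    simp only [Set.mem_iUnion] at hA
    obtain ⟨β, hβ, hA⟩ := hA
    obtain ⟨R, hR, hRB, v, hv, rfl⟩ := hcod β hβ
    obtain ⟨n, rfl⟩ := T.exists_row_eq hR hv (hβ.le.trans hκ.le) hA
    obtain ⟨e, rfl⟩ := exists_indexed hRB
    have h := hG.2 e v
    rw [hG.row_zero] at h
    rcases h hR with ⟨i, hi, hi'⟩ | ⟨i, hi⟩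
    · refine absurd hi ?_
      clear hA hβ h
      induction hv with
      | intro v _ ih =>
        intro hv
        obtain ⟨b, hb, hbv⟩ := hi' v hv
        exact ih b hbv hb hb
    · refine ⟨pair i (pair v n), ?_⟩
      have := (hi n).row_eq (isLocal_step _ B) (lex_trans hR) (acc_lex (by simpa using hv))
        (.inl rfl)
      rw [hier, ← this]
      ext x
      simp
  refine (T.least κ hκ _ hcov).trans ?_
  exact Arith.mem (f := fun s : ℕ => pair s.unpair.1.unpair.1
    (pair s.unpair.1.unpair.2 s.unpair.2)) (by fun_prop)

/-! ### Truth with witnesses -/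

/-- The local conditions, at `t` with auxiliary argument `w`, for a function `g` to describe the
truth set for arithmetic with an oracle `join B G`: `t` is true if `g t ≠ 0`, and in this case
`g t - 1` is a witness. In addition, `t₀` is required to be true. -/
def IsValid (B : Set ℕ) (t₀ : ℕ) (g : ℕ → ℕ) (t w : ℕ) : Prop :=
  (t = t₀ → ¬ g t = 0) ∧ (t.unpair.1.unpair.1 = 0 →
    (t.unpair.1.unpair.2 = 0 → ¬ t.unpair.2.unpair.1 = 1 →
      (¬ g t = 0 ↔ t.unpair.2.unpair.1 = 0 ∧ t.unpair.2.unpair.2 ∈ B)) ∧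
    (¬ t.unpair.1.unpair.2 = 0 →
      (g t = w + 1 → ∃ s, ask t.unpair.1.unpair.2.unpair.1 t.unpair.2 w = some s ∧
        lex (fun _ _ => False) s.unpair.1 t.unpair.1 ∧ g s = 0) ∧
      (g t = 0 → ∀ s, ask t.unpair.1.unpair.2.unpair.1 t.unpair.2 w = some s →
        lex (fun _ _ => False) s.unpair.1 t.unpair.1 → ¬ g s = 0)))

/-- The tree of the finite sequences that satisfy the local conditions, as far as these refer to
values in the sequence. Its branches are the functions that satisfy the local conditions. -/
def validTree (B : Set ℕ) (t₀ : ℕ) (l : List ℕ) : Prop :=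
  ∀ t w, t < l.length →
    (∀ s, ask t.unpair.1.unpair.2.unpair.1 t.unpair.2 w = some s → s < l.length) →
    IsValid B t₀ (fun k => l.getD k 0) t w

section Valid

variable {B : Set ℕ} {t₀ : ℕ}

theorem isValid_congr {g g' : ℕ → ℕ} {t w : ℕ} (ht : g t = g' t)
    (hs : ∀ s, ask t.unpair.1.unpair.2.unpair.1 t.unpair.2 w = some s → g s = g' s) :
    IsValid B t₀ g t w ↔ IsValid B t₀ g' t w := by
  unfold IsValid
  rw [ht]
  have h₁ : (∃ s, ask t.unpair.1.unpair.2.unpair.1 t.unpair.2 w = some s ∧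
      lex (fun _ _ => False) s.unpair.1 t.unpair.1 ∧ g s = 0) ↔
      ∃ s, ask t.unpair.1.unpair.2.unpair.1 t.unpair.2 w = some s ∧
      lex (fun _ _ => False) s.unpair.1 t.unpair.1 ∧ g' s = 0 :=
    exists_congr fun s => and_congr_right fun h => by rw [hs s h]
  have h₂ : (∀ s, ask t.unpair.1.unpair.2.unpair.1 t.unpair.2 w = some s →
      lex (fun _ _ => False) s.unpair.1 t.unpair.1 → ¬ g s = 0) ↔
      ∀ s, ask t.unpair.1.unpair.2.unpair.1 t.unpair.2 w = some s →
      lex (fun _ _ => False) s.unpair.1 t.unpair.1 → ¬ g' s = 0 :=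
    forall_congr' fun s => imp_congr_right fun h => by rw [hs s h]
  rw [h₁, h₂]

theorem isBranch_validTree {g : ℕ → ℕ} :
    IsBranch (validTree B t₀) g ↔ ∀ t w, IsValid B t₀ g t w := by
  constructor
  · intro h t w
    obtain ⟨n, htn, hn⟩ : ∃ n, t < n ∧
        ∀ s, ask t.unpair.1.unpair.2.unpair.1 t.unpair.2 w = some s → s < n := by
      cases hask : ask t.unpair.1.unpair.2.unpair.1 t.unpair.2 w with
      | none => exact ⟨t + 1, by omega, by simp⟩
      | some s =>
        refine ⟨t + s + 1, by omega, ?_⟩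
        rintro s' hs
        obtain rfl := Option.some.inj hs
        omega
    have := h n t w (by simpa only [length_initial] using htn)
      (by simpa only [length_initial] using hn)
    exact (isValid_congr (g := fun k => (initial g n).getD k 0) (g' := g) (getD_initial g htn)
      fun s hs => getD_initial g (hn s hs)).1 this
  · intro h n t w ht hs
    rw [length_initial] at ht hs
    exact (isValid_congr (g := fun k => (initial g n).getD k 0) (g' := g) (getD_initial g ht)
      fun s hs' => getD_initial g (hs s hs')).2 (h t w)

theorem arithIn_isValid : ArithIn B fun a : List ℕ × ℕ × ℕ =>
    IsValid B t₀ (fun k => a.1.getD k 0) a.2.1 a.2.2 := by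
  have hlex : ∀ f g : ((List ℕ × ℕ × ℕ) × ℕ) → ℕ, Primrec f → Primrec g →
      ArithIn B fun a => lex (fun _ _ => False) (f a) (g a) := fun f g hf hg => by
    refine Arith.lex (R := fun _ _ _ _ => False) ?_ hf hg
    exact (Arith.lt (f := fun a : ((List ℕ × ℕ × ℕ) × ℕ) × ℕ × ℕ => a.2.1) (g := fun a => a.2.1)
      (by fun_prop) (by fun_prop)).of_iff (by simp)
  unfold IsValid
  refine .and ?_ (.imp ?_ (.and ?_ ?_))
  · exact .imp (.eq (by fun_prop) (by fun_prop)) (.not (.eq (by fun_prop) (by fun_prop)))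
  · exact .eq (by fun_prop) (by fun_prop)
  · refine .imp (.eq (by fun_prop) (by fun_prop)) (.imp ?_ (.iff ?_ (.and ?_ ?_)))
    · exact .not (.eq (by fun_prop) (by fun_prop))
    · exact .not (.eq (by fun_prop) (by fun_prop))
    · exact .eq (by fun_prop) (by fun_prop)
    · exact Arith.mem (f := fun a : List ℕ × ℕ × ℕ => a.2.1.unpair.2.unpair.2) (by fun_prop)
  · refine .imp ?_ (.and ?_ ?_)
    · exact .not (.eq (by fun_prop) (by fun_prop))
    · refine .imp (.eq (by fun_prop) (by fun_prop)) (.ex (.and ?_ (.and ?_ ?_)))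
      · exact .eq (by fun_prop) (by fun_prop)
      · exact hlex _ _ (by fun_prop) (by fun_prop)
      · exact .eq (by fun_prop) (by fun_prop)
    · refine .imp (.eq (by fun_prop) (by fun_prop)) (.all (.imp ?_ (.imp ?_ ?_)))
      · exact .eq (by fun_prop) (by fun_prop)
      · exact hlex _ _ (by fun_prop) (by fun_prop)
      · exact .not (.eq (by fun_prop) (by fun_prop))

theorem arithIn_validTree : ArithIn B (validTree B t₀) := by
  refine .all (.all (.imp (.lt (by fun_prop) (by fun_prop)) (.imp (.all (.imp
    (.eq (by fun_prop) (by fun_prop)) (.lt (by fun_prop) (by fun_prop)))) ?_)))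
  exact arithIn_isValid.comp (f := fun a : (List ℕ × ℕ) × ℕ => (a.1.1, a.1.2, a.2)) (by fun_prop)

/-- The free part of the oracle that is described by a branch. -/
def oracleOf (g : ℕ → ℕ) : Set ℕ := {y | g (pair (pair 0 0) (pair 1 y)) ≠ 0}

/-- A function that satisfies the local conditions is nonzero exactly at the true positions, for the
oracle that it describes. -/
theorem ne_zero_iff_mem_hier {g : ℕ → ℕ} (hg : ∀ t w, IsValid B t₀ g t w) (n x : ℕ) :
    g (pair (pair 0 n) x) ≠ 0 ↔
      pair (pair 0 n) x ∈ hier (fun _ _ => False) (join B (oracleOf g)) := by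
  induction n using Nat.strong_induction_on generalizing x with
  | _ n ih =>
    rw [mem_hier (acc_false _)]
    have hs : ∀ s : ℕ, lex (fun _ _ => False) s.unpair.1 (pair 0 n) → (g s ≠ 0 ↔
        s ∈ hier (fun _ _ => False) (join B (oracleOf g))) := fun s hs => by
      simp only [lex, Nat.unpair_pair, false_or] at hs
      have := ih _ hs.2 s.unpair.2
      have hpos : pair (pair 0 s.unpair.1.unpair.2) s.unpair.2 = s := by
        rw [← hs.1, Nat.pair_unpair, Nat.pair_unpair]
      rwa [hpos] at this
    rcases Nat.eq_zero_or_pos n with rfl | hn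
    · by_cases hx : x.unpair.1 = 1
      · have : x = pair 1 x.unpair.2 := by rw [← hx, Nat.pair_unpair]
        rw [this]
        simp [step, join, oracleOf]
      · have := ((hg (pair (pair 0 0) x) 0).2 (by simp)).1 (by simp) (by simpa using hx)
        simp only [Nat.unpair_pair] at this
        simp [step, join, this, hx]
    · have hn' : ¬ n = 0 := by omega
      simp only [step, Nat.unpair_pair, hn', false_and, false_or, ne_eq, not_false_eq_true,
        true_and]
      have hw := fun w => ((hg (pair (pair 0 n) x) w).2 (by simp)).2 (by simpa using hn')
      simp only [Nat.unpair_pair] at hw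
      constructor
      · intro h0
        obtain ⟨w, h⟩ := Nat.exists_eq_succ_of_ne_zero h0
        obtain ⟨s, hask, hlex, hs0⟩ := (hw w).1 h
        exact ⟨w, s, hask, hlex, fun hmem => (hs s hlex).2 hmem hs0⟩
      · rintro ⟨w, s, hask, hlex, hmem⟩ h0
        exact hmem ((hs s hlex).1 ((hw w).2 h0 s hask hlex))

theorem exists_isValid (G : Set ℕ)
    (h : t₀ ∈ hier (fun _ _ => False) (join B G)) : ∃ g, ∀ t w, IsValid B t₀ g t w := by
  classical
  set H := hier (fun _ _ => False) (join B G) with hH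
  have hmem : ∀ t : ℕ, t ∈ H ↔ step (fun _ _ => False) (join B G) H t.unpair.1 t.unpair.2 :=
    fun t => by
      have := mem_hier (R := fun _ _ => False) (B := join B G) (acc_false _) (p := t.unpair.1)
        t.unpair.2
      rwa [Nat.pair_unpair] at this
  let W : ℕ → ℕ → Prop := fun t w => ∃ s, ask t.unpair.1.unpair.2.unpair.1 t.unpair.2 w = some s ∧
    lex (fun _ _ => False) s.unpair.1 t.unpair.1 ∧ s ∉ H
  let g : ℕ → ℕ := fun t => if t ∈ H then (if hw : ∃ w, W t w then hw.choose + 1 else 1) else 0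
  have hg : ∀ t, g t = 0 ↔ t ∉ H := fun t => by
    simp only [g]
    split_ifs <;> simp_all
  refine ⟨g, fun t w => ⟨?_, fun _ => ⟨fun h0 h1 => ?_, fun h0 => ⟨fun hw => ?_, ?_⟩⟩⟩⟩
  · rintro rfl
    simpa [hg] using h
  · rw [hg, not_not, hmem]
    simp [step, h0, join, h1]
  · simp only [hg]
    have ht : t ∈ H := by
      by_contra h
      rw [(hg t).2 h] at hw
      omega
    have hex : ∃ w, W t w := by
      rw [hmem] at ht
      rcases ht with ht | ht
      · exact absurd ht.1 h0
      · exact ht.2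
    have : g t = hex.choose + 1 := by simp [g, ht, hex]
    have hw' : hex.choose = w := by omega
    have := hex.choose_spec
    rwa [hw'] at this
  · intro h s hask hlex hs
    rw [hg] at h hs
    exact h ((hmem t).2 (.inr ⟨h0, w, s, hask, hlex, hs⟩))

end Valid

/-- The first ordinal that is not coded is not below the length of a tower. Otherwise the set `P κ`
would be arithmetical in every rich set, so that, by the category argument, it would be decided by
the branches of an arithmetical tree and belong to `D κ`. -/
theorem IsTower.not_lt_of_not_isCoded {lam κ : Ordinal.{0}} {B : Set ℕ}
    {D : Ordinal.{0} → Set (Set ℕ)} {P : Ordinal.{0} → Set ℕ} (T : IsTower lam B D P)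
    (hcod : ∀ β < κ, IsCoded B β) (hκ : ¬ IsCoded B κ) : ¬ κ < lam := by
  intro hlt
  have hlim := isSuccLimit_of_isCoded hcod hκ
  have hcod' : ∀ β, IsCoded B β → β < κ := fun β hβ => lt_of_not_ge fun h => hκ (hβ.of_le h)
  obtain ⟨n₀, hn₀⟩ := arith_isRich B
  set t₀ := pair (pair 0 n₀) (encode ()) with ht₀
  have hbranch : ∃ g, IsBranch (validTree B t₀) g := by
    obtain ⟨G, hG⟩ := exists_isRich B
    obtain ⟨g, hg⟩ := exists_isValid (t₀ := t₀) (B := B) G ((hn₀ G ()).1 hG)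
    exact ⟨g, isBranch_validTree.2 hg⟩
  obtain ⟨n, m, g₀, hg₀, hA⟩ := exists_uniform_rule (T := validTree B t₀) hbranch (A := P κ)
    (h := fun n x => pair (pair 0 n) x) fun g hg => by
      have hg' := isBranch_validTree.1 hg
      have hrich : IsRich B (oracleOf g) := by
        refine (hn₀ _ ()).2 ((ne_zero_iff_mem_hier hg' _ _).1 ?_)
        exact (hg' t₀ 0).1 rfl
      obtain ⟨n, hn⟩ := (T.redTo_of_isRich hlt hlim hcod hrich).trans
        (redTo_join_right B (oracleOf g))
      refine ⟨n, fun x => ?_⟩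
      rw [ne_zero_iff_mem_hier hg']
      simpa using hn () x
  exact (T.covers κ hlt).notMem (T.isIdeal hlt.le)
    (T.mem_of_branches hlt.le hcod' arithIn_validTree (h := fun x => pair (pair 0 n) x)
      (by fun_prop) hg₀ hA)

/-! ### Least enumerations of the ideals of a tower -/

namespace IsTower

variable {lam κ : Ordinal.{0}} {B : Set ℕ} {D : Ordinal.{0} → Set (Set ℕ)}
  {P : Ordinal.{0} → Set ℕ}

/-- Well-foundedness below `v` is recognized inside `D κ`: it suffices that `D κ` contains a set
that satisfies the recursion equation of the hierarchy up to `v` and that no member of `D κ`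
witnesses that `v` is not accessible. Indeed, the existence of the hierarchy bounds the ranks of the
accessible points below `v`, so that these points form a member of `D κ`. -/
theorem acc_of_isApprox (T : IsTower lam B D P) (hκ : κ ≤ lam) (hlim : Order.IsSuccLimit κ)
    (hcod : ∀ β < κ, IsCoded B β) {R : ℕ → ℕ → Prop} (hR : ∀ a b c, R a b → R b c → R a c)
    (hRB : ArithIn B fun a : ℕ × ℕ => R a.1 a.2) {v n : ℕ} {X : Set ℕ} (hX : X ∈ D κ)
    (happ : IsApprox (lex R) (step R B) (pair v n) X)
    (hmin : ∀ Z ∈ D κ, v ∈ Z → ∃ a ∈ Z, ∀ b ∈ Z, ¬ R b a) : Acc R v := by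
  by_contra hv
  rw [T.limit κ hκ hlim] at hX
  simp only [Set.mem_iUnion] at hX
  obtain ⟨β, hβ, hX⟩ := hX
  have hβlam : β < lam := hβ.trans_le hκ
  have hβs : Order.succ β < κ := hlim.succ_lt hβ
  have hrk : ∀ w, R w v → Acc R w → rk R w ≤ β := by
    intro w hwv hw
    by_contra! hlt
    obtain ⟨w', hw'v, hw', hw'β⟩ : ∃ w', R w' v ∧ Acc R w' ∧ rk R w' = Order.succ β := by
      rcases (Order.succ_le_of_lt hlt).eq_or_lt with h | h
      · exact ⟨w, hwv, hw, h.symm⟩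
      · obtain ⟨w', hw', h'⟩ := exists_rk_eq hR hw h
        exact ⟨w', hR _ _ _ hw' hwv, hw.inv hw', h'⟩
    have hP : P β ∈ D (rk R w') := by
      rw [hw'β, T.succ β hβlam]
      exact .refl _
    obtain ⟨k, hk⟩ := T.exists_row_eq hR hw' (hw'β ▸ (hβs.trans_le hκ).le) hP
    rw [hier, ← happ.row_eq (isLocal_step R B) (lex_trans hR) (acc_lex (by simpa using hw'))
      (.inr (.inl (by simpa using hw'v)))] at hk
    exact (T.covers β hβlam).notMem (T.isIdeal hβlam.le)
      ((T.isIdeal hβlam.le).mem_of_redTo _ hX _ (redTo_row hk))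
  obtain ⟨U, hU, hUB, u, hu, rfl⟩ := hcod β hβ
  have hE := T.mono hβs.le hκ (T.compare_mem hU hRB hUB hu hβlam)
  have hEmem : ∀ s, pair u s ∈ solutionUpTo U (compareStep R U) u ↔
      pair u s ∈ solution U (compareStep R U) := fun s => by
    simp [solutionUpTo]
  obtain ⟨C, hC, hBC, hEC⟩ := (T.isIdeal hκ).exists_oracle₂ (T.oracle_mem hκ) hE
  have hZ : {s | (s = v ∨ R s v) ∧ pair u s ∉ solutionUpTo U (compareStep R U) u} ∈ D κ := by
    refine (T.isIdeal hκ).mem_of_arithIn hC (.and (.or (.eq (f := fun s : ℕ => s) (by fun_prop)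
      (by fun_prop)) ?_) (.not ?_))
    · exact (hRB.of_redTo hBC).comp (f := fun s : ℕ => (s, v)) (by fun_prop)
    · exact Arith.mem' hEC (f := fun s : ℕ => pair u s) (by fun_prop)
  obtain ⟨a, ⟨hav, ha⟩, hamin⟩ := hmin _ hZ
    ⟨.inl rfl, by rw [hEmem]; exact not_compare_of_not_acc hu hv⟩
  rw [hEmem] at ha
  have hacc : ¬ Acc R a := by
    intro h
    rcases hav with rfl | hav
    · exact hv h
    · exact ha (compare_of_rk_le hU hu h (hrk a hav h))
  refine hacc ⟨a, fun b hb => by_contra fun hb' => hamin b ⟨.inr ?_, ?_⟩ hb⟩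
  · rcases hav with rfl | hav
    exacts [hb, hR _ _ _ hb hav]
  · rw [hEmem]
    exact not_compare_of_not_acc hu hb'

/-- Below the first ordinal `κ` that is not coded, the rows of all hierarchies along well-founded
relations with arithmetical indices enumerate `D κ`. This enumeration can be recovered from every
other one, as quantification over the members of `D κ` then becomes numerical. -/
theorem exists_enumerates_of_not_isCoded (T : IsTower lam B D P) (hκ : κ ≤ lam)
    (hcod : ∀ β < κ, IsCoded B β) (hcod' : ¬ IsCoded B κ) :
    ∃ Q, Enumerates (D κ) Q ∧ ∀ P', Enumerates (D κ) P' → RedTo Q P' := by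
  have hlim := isSuccLimit_of_isCoded hcod hcod'
  have hlt : ∀ β, IsCoded B β → β < κ := fun β hβ => lt_of_not_ge fun h => hcod' (hβ.of_le h)
  have hD := T.isIdeal hκ
  set I := indexed (hier (fun _ _ => False) B) with hI
  have hIB : ∀ e, ArithIn B fun a : ℕ × ℕ => I e a.1 a.2 := arithIn_indexed B
  have hrk : ∀ e v, (∀ a b c, I e a b → I e b c → I e a c) → Acc (I e) v → rk (I e) v < κ :=
    fun e v hR hv => hlt _ ⟨I e, hR, hIB e, v, hv, rfl⟩
  refine ⟨{t | (∀ a b c, I t.unpair.1.unpair.1 a b → I t.unpair.1.unpair.1 b c →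
      I t.unpair.1.unpair.1 a c) ∧ Acc (I t.unpair.1.unpair.1) t.unpair.1.unpair.2.unpair.1 ∧
      pair t.unpair.1.unpair.2 t.unpair.2 ∈ hier (I t.unpair.1.unpair.1) B}, ?_, fun P' hP' => ?_⟩
  · ext A
    constructor
    · intro hA
      rw [T.limit κ hκ hlim] at hA
      simp only [Set.mem_iUnion] at hA
      obtain ⟨β, hβ, hA⟩ := hA
      obtain ⟨R, hR, hRB, v, hv, rfl⟩ := hcod β hβ
      obtain ⟨n, rfl⟩ := T.exists_row_eq hR hv (hβ.le.trans hκ) hA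
      obtain ⟨e, rfl⟩ := exists_indexed hRB
      refine ⟨pair e (pair v n), ?_⟩
      ext x
      simp only [mem_row, Set.mem_ofPred_eq, Nat.unpair_pair]
      exact ⟨fun h => h.2.2, fun h => ⟨hR, hv, h⟩⟩
    · rintro ⟨p, rfl⟩
      by_cases h : (∀ a b c, I p.unpair.1 a b → I p.unpair.1 b c → I p.unpair.1 a c) ∧
          Acc (I p.unpair.1) p.unpair.2.unpair.1
      · have hr := hrk _ _ h.1 h.2
        have := T.mono (Order.succ_le_of_lt hr) hκ (T.row_hier_mem h.1 (hIB _) h.2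
          (hr.trans_le hκ) p.unpair.2.unpair.2)
        convert this using 1
        ext x
        simp only [mem_row, Set.mem_ofPred_eq, Nat.unpair_pair, Nat.pair_unpair]
        exact ⟨fun h => h.2.2, fun h' => ⟨h.1, h.2, h'⟩⟩
      · refine hD.mem_of_arithIn (T.oracle_mem hκ) ((Arith.lt (f := fun x : ℕ => x)
          (g := fun x => x) (by fun_prop) (by fun_prop)).of_iff fun _ x => ?_)
        simp only [mem_row, Set.mem_ofPred_eq, Nat.unpair_pair, lt_irrefl, iff_false]
        exact fun h' => h ⟨h'.1, h'.2.1⟩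
  · have hB : RedTo B P' := hP'.covers.redTo (T.oracle_mem hκ)
    have hP : RedTo P' P' := .refl P'
    have hind : ArithIn P' fun a : ℕ × ℕ × ℕ => I a.1 a.2.1 a.2.2 := by
      have : RedTo (truth B) P' := truth_redTo fun A hA => hP'.covers A
        (T.mono zero_le hκ (by rwa [T.zero]))
      refine (Arith.mem' this (f := fun a : ℕ × ℕ × ℕ => pair a.1 (pair a.2.1 a.2.2))
        (by fun_prop)).of_iff fun _ a => ?_
      simp [hI, indexed, truth]
    have hform : ArithIn P' fun t : ℕ =>
        (∀ a b c : ℕ, I t.unpair.1.unpair.1 a b → I t.unpair.1.unpair.1 b c →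
          I t.unpair.1.unpair.1 a c) ∧
        (∀ j : ℕ, t.unpair.1.unpair.2.unpair.1 ∈ row P' j →
          ∃ a : ℕ, a ∈ row P' j ∧ ∀ b : ℕ, b ∈ row P' j → ¬ I t.unpair.1.unpair.1 b a) ∧
        ∃ i : ℕ, IsApprox (lex (I t.unpair.1.unpair.1)) (step (I t.unpair.1.unpair.1) B)
          t.unpair.1.unpair.2 (row P' i) ∧ pair t.unpair.1.unpair.2 t.unpair.2 ∈ row P' i := by
      refine .and (.all (.all (.all (.imp ?_ (.imp ?_ ?_))))) (.and (.all (.imp ?_ (.ex (.and ?_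
        (.all (.imp ?_ (.not ?_))))))) (.ex (.and ?_ ?_)))
      · exact hind.comp (f := fun a : ((ℕ × ℕ) × ℕ) × ℕ =>
          (a.1.1.1.unpair.1.unpair.1, a.1.1.2, a.1.2)) (by fun_prop)
      · exact hind.comp (f := fun a : ((ℕ × ℕ) × ℕ) × ℕ =>
          (a.1.1.1.unpair.1.unpair.1, a.1.2, a.2)) (by fun_prop)
      · exact hind.comp (f := fun a : ((ℕ × ℕ) × ℕ) × ℕ =>
          (a.1.1.1.unpair.1.unpair.1, a.1.1.2, a.2)) (by fun_prop)
      · exact Arith.mem (f := fun a : ℕ × ℕ => pair a.2 a.1.unpair.1.unpair.2.unpair.1)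
          (by fun_prop)
      · exact Arith.mem (f := fun a : (ℕ × ℕ) × ℕ => pair a.1.2 a.2) (by fun_prop)
      · exact Arith.mem (f := fun a : ((ℕ × ℕ) × ℕ) × ℕ => pair a.1.1.2 a.2) (by fun_prop)
      · exact hind.comp (f := fun a : ((ℕ × ℕ) × ℕ) × ℕ =>
          (a.1.1.1.unpair.1.unpair.1, a.2, a.1.2)) (by fun_prop)
      · refine Arith.isApprox_step (R := fun _ (a : ℕ × ℕ) => I a.1.unpair.1.unpair.1)
          (B := fun _ => B) (X := fun _ (a : ℕ × ℕ) => row P' a.2) ?_ hB ?_ (by fun_prop)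
        · exact hind.comp (f := fun a : (ℕ × ℕ) × ℕ × ℕ =>
            (a.1.1.unpair.1.unpair.1, a.2.1, a.2.2)) (by fun_prop)
        · exact Arith.mem (f := fun a : (ℕ × ℕ) × ℕ => pair a.1.2 a.2) (by fun_prop)
      · exact Arith.mem (f := fun a : ℕ × ℕ =>
          pair a.2 (pair a.1.unpair.1.unpair.2 a.1.unpair.2)) (by fun_prop)
    refine hform.of_iff fun _ t => ?_
    obtain ⟨e, v, n, x, rfl⟩ : ∃ e v n x, t = pair (pair e (pair v n)) x :=
      ⟨t.unpair.1.unpair.1, t.unpair.1.unpair.2.unpair.1, t.unpair.1.unpair.2.unpair.2,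
        t.unpair.2, by simp⟩
    simp only [Set.mem_ofPred_eq, Nat.unpair_pair]
    refine and_congr_right fun hR => ?_
    have hrow : ∀ i, row P' i ∈ D κ := fun i => by rw [hP']; exact ⟨i, rfl⟩
    have hpv : Acc (I e) v → Acc (lex (I e)) (pair v n) := fun hv => acc_lex (by simpa using hv)
    constructor
    · rintro ⟨hv, hx⟩
      refine ⟨fun j hj => ?_, ?_⟩
      · by_contra! hcon
        clear hx hpv
        induction hv with
        | intro v _ ih =>
          obtain ⟨b, hb, hbv⟩ := hcon v hj
          exact ih b hbv hb
      · have hr := hrk e v hR hv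
        obtain ⟨i, hi⟩ := hP'.covers _ (T.mono (Order.succ_le_of_lt hr) hκ
          (T.hier_mem hR (hIB e) hv (hr.trans_le hκ) n))
        refine ⟨i, ?_, ?_⟩
        · rw [← hi]
          exact isApprox_solutionUpTo (isLocal_step _ _) (lex_trans hR) (hpv hv)
        · rw [← hi]
          exact ⟨.inl (by simp), hx⟩
    · rintro ⟨hmin, i, happ, hx⟩
      have hv : Acc (I e) v := T.acc_of_isApprox hκ hlim hcod hR (hIB e) (hrow i) happ
        fun Z hZ hvZ => by
          obtain ⟨j, rfl⟩ := hP'.covers Z hZ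
          exact hmin j hvZ
      refine ⟨hv, ?_⟩
      have := Set.ext_iff.1 (happ.row_eq (isLocal_step _ _) (lex_trans hR) (hpv hv) (.inl rfl)) x
      exact this.1 hx

/-- Every ideal of the tower has a least enumeration. Except for the top of the tower, it is
arithmetical in every set that covers the ideal. -/
theorem exists_least_enumeration (T : IsTower lam B D P) {α : Ordinal} (hα : α ≤ lam) :
    ∃ Q, Enumerates (D α) Q ∧ (∀ P', Enumerates (D α) P' → RedTo Q P') ∧
      (α < lam → ∀ P', Covers (D α) P' → RedTo Q P') := by
  suffices h : (∃ Q, Enumerates (D α) Q ∧ ∀ P', Covers (D α) P' → RedTo Q P') ∨ ¬ α < lam ∧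
      ∃ Q, Enumerates (D α) Q ∧ ∀ P', Enumerates (D α) P' → RedTo Q P' by
    rcases h with ⟨Q, hQ, h⟩ | ⟨hlt, Q, hQ, h⟩
    · exact ⟨Q, hQ, fun P' hP' => h P' hP'.covers, fun _ => h⟩
    · exact ⟨Q, hQ, h, fun h' => absurd h' hlt⟩
  rcases Ordinal.zero_or_succ_or_isSuccLimit α with rfl | ⟨γ, rfl⟩ | hlim
  · rw [T.zero]
    exact .inl ⟨truth B, enumerates_truth B, fun P' => truth_redTo⟩
  · rw [T.succ γ ((Order.lt_succ γ).trans_le hα)]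
    exact .inl ⟨truth (P γ), enumerates_truth _, fun P' => truth_redTo⟩
  · by_cases hcod : IsCoded B α
    · exact .inl (T.exists_enumerates_of_isCoded hcod hα hlim)
    · -- the first ordinal that is not coded is then the length of the tower
      obtain ⟨κ, hκ, hmin⟩ := WellFounded.has_min (wellFounded_lt (α := Ordinal.{0}))
        {β | ¬ IsCoded B β} ⟨α, hcod⟩
      have hmin' : ∀ β < κ, IsCoded B β := fun β hβ => by_contra fun h => hmin β h hβ
      have hle : κ ≤ α := le_of_not_gt (hmin α hcod)
      have hge : lam ≤ κ := le_of_not_gt (T.not_lt_of_not_isCoded hmin' hκ)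
      obtain rfl : κ = α := hle.antisymm (hα.trans hge)
      exact .inr ⟨hge.not_gt, T.exists_enumerates_of_not_isCoded hα hmin' hκ⟩

end IsTower

/-! ### Definability in a structure -/

section Definability

open FirstOrder FirstOrder.Language

variable {K : Struct} {α : Type}

/-- The set `S` of tuples is definable in `K` without parameters. -/
abbrev Def (K : Struct) (S : Set (α → ℕ)) : Prop := (∅ : Set ℕ).Definable K.lang S

/-- The function `f` on tuples is definable in `K` without parameters. -/
abbrev DefFun (K : Struct) (f : (α → ℕ) → ℕ) : Prop := (∅ : Set ℕ).DefinableFun K.lang f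

theorem Def.exists {p : (α → ℕ) → ℕ → Prop}
    (h : Def K {w : α ⊕ Unit → ℕ | p (w ∘ Sum.inl) (w (Sum.inr ()))}) :
    Def K {v | ∃ x, p v x} := by
  convert Set.Definable.exists_of_finite h using 1
  ext v
  constructor
  · rintro ⟨x, hx⟩
    exact ⟨fun _ => x, hx⟩
  · rintro ⟨u, hu⟩
    exact ⟨u (), hu⟩

theorem Def.forall {p : (α → ℕ) → ℕ → Prop}
    (h : Def K {w : α ⊕ Unit → ℕ | p (w ∘ Sum.inl) (w (Sum.inr ()))}) :
    Def K {v | ∀ x, p v x} := by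
  convert Set.Definable.forall_of_finite h using 1
  ext v
  constructor
  · exact fun hv u => hv (u ())
  · exact fun hv x => hv fun _ => x

theorem defFun_of_mem {n : ℕ} {f : (Fin n → ℕ) → ℕ} (hf : Symb.func n f ∈ K.symbols) :
    DefFun K f :=
  Set.DefinableFun.fun_symbol (L := K.lang) (M := ℕ) ⟨f, hf⟩

theorem def_of_mem {n : ℕ} {hn : 0 < n} {A : Set (Fin n → ℕ)}
    (hA : Symb.pred n hn A ∈ K.symbols) : Def K A := by
  rw [Def, Set.empty_definable_iff]
  let r : K.lang.Relations n := ⟨A, hn, hA⟩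
  refine ⟨r.formula fun i => Term.var i, ?_⟩
  ext v
  rw [Set.mem_ofPred_eq, Formula.realize_rel]
  rfl

theorem DefFun.of_graph {f : (α → ℕ) → ℕ} {S : Set (Option α → ℕ)} (hS : Def K S)
    (h : ∀ w, f (w ∘ some) = w none ↔ w ∈ S) : DefFun K f := by
  have : Function.tupleGraph f = S := Set.ext h
  rwa [← this] at hS

theorem DefFun.map {n : ℕ} {F : (Fin n → ℕ) → ℕ} (hF : DefFun K F) {f : Fin n → (α → ℕ) → ℕ}
    (hf : ∀ i, DefFun K (f i)) : DefFun K fun v => F fun i => f i v :=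
  Set.DefinableFun.comp (g := fun v i => f i v) hf hF

theorem Def.preimage {n : ℕ} {S : Set (Fin n → ℕ)} (hS : Def K S) {f : Fin n → (α → ℕ) → ℕ}
    (hf : ∀ i, DefFun K (f i)) : Def K {v | (fun i => f i v) ∈ S} :=
  Set.Definable.preimage_map (F := fun v i => f i v) hf hS

theorem defFun_var (i : α) : DefFun K fun v => v i := Set.DefinableFun.proj K.lang

variable {f g : (α → ℕ) → ℕ}

theorem DefFun.succ (hf : DefFun K f) : DefFun K fun v => f v + 1 :=
  DefFun.map (F := fun v : Fin 1 → ℕ => v 0 + 1)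
    (defFun_of_mem (K.arith_subset (by simp [arith]))) fun _ => hf

theorem DefFun.add (hf : DefFun K f) (hg : DefFun K g) : DefFun K fun v => f v + g v :=
  DefFun.map (F := fun v : Fin 2 → ℕ => v 0 + v 1) (f := ![f, g])
    (defFun_of_mem (K.arith_subset (by simp [arith])))
    (by intro i; fin_cases i <;> assumption)

theorem DefFun.mul (hf : DefFun K f) (hg : DefFun K g) : DefFun K fun v => f v * g v :=
  DefFun.map (F := fun v : Fin 2 → ℕ => v 0 * v 1) (f := ![f, g])
    (defFun_of_mem (K.arith_subset (by simp [arith])))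
    (by intro i; fin_cases i <;> assumption)

theorem DefFun.eq (hf : DefFun K f) (hg : DefFun K g) : Def K {v | f v = g v} :=
  hf.ofPred_eq hg

theorem DefFun.lt (hf : DefFun K f) (hg : DefFun K g) : Def K {v | f v < g v} :=
  Def.preimage (S := {v : Fin 2 → ℕ | v 0 < v 1}) (f := ![f, g])
    (def_of_mem (hn := two_pos) (K.arith_subset (by simp [arith, Symb.pred₂])))
    (by intro i; fin_cases i <;> assumption)

theorem defFun_zero : DefFun K fun _ : α → ℕ => 0 := by
  have : Def K {w : Option α → ℕ | w none + w none = w none} :=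
    DefFun.eq (.add (defFun_var _) (defFun_var _)) (defFun_var _)
  exact .of_graph this fun w => by simp [eq_comm]

theorem DefFun.mod_succ (hf : DefFun K f) (hg : DefFun K g) :
    DefFun K fun v => f v % (g v + 1) := by
  refine DefFun.map (F := fun v : Fin 2 → ℕ => v 0 % (v 1 + 1)) (f := ![f, g]) ?_
    (by intro i; fin_cases i <;> assumption)
  have : Def K {w : Option (Fin 2) → ℕ | w none < w (some 1) + 1 ∧
      ∃ q, w (some 0) = (w (some 1) + 1) * q + w none} :=
    Set.Definable.inter (DefFun.lt (defFun_var _) (.succ (defFun_var _))) (Def.exists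
      (p := fun w q => w (some 0) = (w (some 1) + 1) * q + w none)
      (DefFun.eq (defFun_var _) (.add (.mul (.succ (defFun_var _)) (defFun_var _)) (defFun_var _))))
  refine .of_graph this fun w => ?_
  simp only [Function.comp_apply, Set.mem_ofPred_eq]
  constructor
  · intro h
    refine ⟨h ▸ Nat.mod_lt _ (Nat.succ_pos _), w (some 0) / (w (some 1) + 1), ?_⟩
    rw [← h, Nat.div_add_mod]
  · rintro ⟨h, q, hq⟩
    rw [hq, Nat.mul_add_mod, Nat.mod_eq_of_lt h]

/-- Primitive recursion is definable, since finite sequences can be coded by Gödel's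
beta function. -/
theorem defFun_prec {n : ℕ} {f : (Fin n → ℕ) → ℕ} {g : (Fin (n + 2) → ℕ) → ℕ} (hf : DefFun K f)
    (hg : DefFun K g) : DefFun K fun v : Fin (n + 1) → ℕ =>
      (v 0).rec (f (Fin.tail v)) fun y IH => g (Fin.cons y (Fin.cons IH (Fin.tail v))) := by
  let β : ℕ → ℕ → ℕ → ℕ := fun a b i => a % ((i + 1) * b + 1)
  have hβ : ∀ {γ : Type} {a b i : (γ → ℕ) → ℕ}, DefFun K a → DefFun K b → DefFun K i →
      DefFun K fun v => β (a v) (b v) (i v) := fun ha hb hi => .mod_succ ha (.mul (.succ hi) hb)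
  have hf' : ∀ {γ : Type} {u : Fin n → (γ → ℕ) → ℕ}, (∀ i, DefFun K (u i)) →
      DefFun K fun v => f fun i => u i v := fun hu => hf.map hu
  have hg' : ∀ {γ : Type} {y z : (γ → ℕ) → ℕ} {u : Fin n → (γ → ℕ) → ℕ}, DefFun K y →
      DefFun K z → (∀ i, DefFun K (u i)) →
      DefFun K fun v => g (Fin.cons (y v) (Fin.cons (z v) fun i => u i v)) := by
    intro γ y z u hy hz hu
    have := hg.map (f := Fin.cons y (Fin.cons z u)) (Fin.cases hy (Fin.cases hz hu))
    convert this using 3 with v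
    ext i
    refine Fin.cases rfl (fun i => Fin.cases rfl (fun i => rfl) i) i
  have h : Def K {w : Option (Fin (n + 1)) → ℕ | ∃ a b, β a b 0 = f (fun i => w (some i.succ)) ∧
      (∀ i, i < w (some 0) → β a b (i + 1) =
        g (Fin.cons i (Fin.cons (β a b i) fun j => w (some j.succ)))) ∧
      β a b (w (some 0)) = w none} := by
    refine Def.exists (Def.exists (Set.Definable.inter (DefFun.eq ?_ ?_)
      (Set.Definable.inter (Def.forall (Set.Definable.himp (DefFun.lt ?_ ?_) (DefFun.eq ?_ ?_)))
        (DefFun.eq ?_ ?_))))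
    · exact hβ (defFun_var _) (defFun_var _) defFun_zero
    · exact hf' fun i => defFun_var _
    · exact defFun_var _
    · exact defFun_var _
    · exact hβ (defFun_var _) (defFun_var _) (.succ (defFun_var _))
    · exact hg' (defFun_var _) (hβ (defFun_var _) (defFun_var _) (defFun_var _))
        fun i => defFun_var _
    · exact hβ (defFun_var _) (defFun_var _) (defFun_var _)
    · exact defFun_var _
  refine .of_graph h fun w => ?_
  simp only [Function.comp_apply, Set.mem_ofPred_eq]
  set t : Fin n → ℕ := fun i => w (some i.succ) with ht
  have htail : Fin.tail (w ∘ some) = t := rfl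
  rw [htail]
  let ρ : ℕ → ℕ := fun k => k.rec (f t) fun y IH => g (Fin.cons y (Fin.cons IH t))
  change ρ (w (some 0)) = w none ↔ _
  constructor
  · intro hw
    let l := (List.range (w (some 0) + 1)).map ρ
    have hl : ∀ i, i ≤ w (some 0) →
        β (Nat.unbeta l).unpair.1 (Nat.unbeta l).unpair.2 i = ρ i := fun i hi => by
      have := Nat.beta_unbeta_coe l ⟨i, by simp [l]; omega⟩
      simpa [l, Nat.beta, β] using this
    refine ⟨_, _, hl 0 (Nat.zero_le _), fun i hi => ?_, ?_⟩
    · rw [hl (i + 1) hi, hl i hi.le]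
    · rw [hl _ le_rfl, hw]
  · rintro ⟨a, b, h0, hs, hw⟩
    have : ∀ i, i ≤ w (some 0) → β a b i = ρ i := fun i => by
      induction i with
      | zero => exact fun _ => h0
      | succ i ih =>
        intro hi
        rw [hs i hi, ih (Nat.le_of_succ_le hi)]
    rw [← this _ le_rfl, hw]

theorem defFun_of_primrec' {n : ℕ} {f : List.Vector ℕ n → ℕ} (hf : Nat.Primrec' f) :
    DefFun K fun v : Fin n → ℕ => f (List.Vector.ofFn v) := by
  induction hf with
  | zero => exact defFun_zero
  | succ =>
    exact DefFun.succ (K := K) (defFun_var (0 : Fin 1))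
  | get i => simpa using defFun_var (K := K) i
  | @comp m n f g _ _ ihf ihg => exact ihf.map (f := fun i v => g i (List.Vector.ofFn v)) ihg
  | @prec n f g _ _ ihf ihg =>
    exact defFun_prec ihf ihg

theorem defFun_of_primrec {n : ℕ} {f : (Fin n → ℕ) → ℕ} (hf : Primrec f) : DefFun K f := by
  have := defFun_of_primrec' (K := K) (Nat.Primrec'.of_prim
    (f := fun u : List.Vector ℕ n => f u.get) (hf.comp Primrec.vector_get'))
  convert this using 2 with v
  congr 1
  ext i
  simp

theorem def_of_primrecPred {n : ℕ} {p : (Fin n → ℕ) → Prop} (hp : PrimrecPred p) :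
    Def K {v | p v} := by
  classical
  have : DefFun K fun v : Fin n → ℕ => if p v then 0 else 1 :=
    defFun_of_primrec (Primrec.ite hp (Primrec.const _) (Primrec.const _))
  convert this.eq defFun_zero using 1
  ext v
  by_cases h : p v <;> simp [h]

end Definability

/-! ### The definable sets of a structure as an arithmetical ideal -/

/-- The code of a tuple, for the encoding for which the primitive recursive functions on tuples
are defined. -/
def tupleCode {n : ℕ} (v : Fin n → ℕ) : ℕ := @encode _ Primcodable.toEncodable v

theorem primrec_tupleCode {n : ℕ} : Primrec (tupleCode : (Fin n → ℕ) → ℕ) := Primrec.encode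

/-- The set of the codes of the tuples in `S`. -/
def codes {n : ℕ} (S : Set (Fin n → ℕ)) : Set ℕ := {m | ∃ v ∈ S, tupleCode v = m}

@[simp] theorem tupleCode_mem_codes {n : ℕ} {S : Set (Fin n → ℕ)} {v : Fin n → ℕ} :
    tupleCode v ∈ codes S ↔ v ∈ S := by
  simp [codes, tupleCode, encode_inj]

/-- The code of a symbol: the codes of the tuples in a predicate or in the graph of a function. -/
def Symb.code : Symb → Set ℕ
  | .pred _ _ A => codes A
  | .func n f => codes {w : Fin (n + 1) → ℕ | f (fun i => w i.succ) = w 0}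

section Ideal

open FirstOrder FirstOrder.Language

variable {K : Struct}

theorem preimage_def {X : Set ℕ} (hX : X ∈ K.D) {α : Type} {f : (α → ℕ) → ℕ}
    (hf : DefFun K f) : Def K {v | f v ∈ X} :=
  Def.preimage (S := {v : Fin 1 → ℕ | v 0 ∈ X}) hX (f := fun _ => f) fun _ => hf

theorem preimage_mem_D {X : Set ℕ} (hX : X ∈ K.D) {f : ℕ → ℕ} (hf : Primrec f) :
    {x | f x ∈ X} ∈ K.D :=
  preimage_def hX (f := fun v : Fin 1 → ℕ => f (v 0)) (defFun_of_primrec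
    (hf.comp (Primrec.fin_app.comp Primrec.id (Primrec.const 0))))

theorem mem_D_of_primrecPred {p : ℕ → Prop} (hp : PrimrecPred p) : {x | p x} ∈ K.D :=
  def_of_primrecPred (hp.comp (Primrec.fin_app.comp Primrec.id (Primrec.const 0)))

/-- The rows of the truth set of a definable oracle are definable, by induction on their index. -/
theorem row_mem_D {A : Set ℕ} (hA : A ∈ K.D) (n : ℕ) :
    {x | pair (pair 0 n) x ∈ hier (fun _ _ => False) A} ∈ K.D := by
  induction n using Nat.strong_induction_on with
  | _ n ih =>
    rcases Nat.eq_zero_or_pos n with rfl | hn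
    · convert hA using 1
      ext x
      rw [Set.mem_ofPred_eq, mem_hier (acc_false _)]
      simp [step]
    have hask : ∀ c : ℕ, Def K {w : (Fin 1 ⊕ Unit) ⊕ Unit → ℕ |
        ask n.unpair.1 (w (.inl (.inl 0))) (w (.inl (.inr ()))) =
          some (pair (pair 0 c) (w (.inr ())))} := fun c => by
      have happ : ∀ i : Fin 3, Primrec fun u : Fin 3 → ℕ => u i := fun i =>
        Primrec.fin_app.comp Primrec.id (Primrec.const i)
      have h3 : Def K {u : Fin 3 → ℕ | ask n.unpair.1 (u 0) (u 1) =
          some (pair (pair 0 c) (u 2))} := by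
        refine def_of_primrecPred (Primrec.eq.comp ?_ ?_)
        · exact primrec_ask (primrec_const _) (happ 0) (happ 1)
        · exact primrec_some (primrec_pair (primrec_const _) (happ 2))
      exact Set.Definable.preimage_comp (![Sum.inl (Sum.inl 0), Sum.inl (Sum.inr ()), Sum.inr ()] :
        Fin 3 → (Fin 1 ⊕ Unit) ⊕ Unit) h3
    have h : Def K {v : Fin 1 → ℕ | ∃ w z, v ∈ ⋃ c : Fin n, {v : Fin 1 → ℕ |
        ask n.unpair.1 (v 0) w = some (pair (pair 0 c) z) ∧
          ¬ pair (pair 0 c) z ∈ hier (fun _ _ => False) A}} := by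
      refine Def.exists (Def.exists ?_)
      convert Set.definable_iUnion_of_finite fun c : Fin n => (hask c).inter
        (preimage_def (ih c c.2) (f := fun w : (Fin 1 ⊕ Unit) ⊕ Unit → ℕ => w (.inr ()))
          (defFun_var _)).compl using 1
      ext w
      simp
    refine (congrArg (Def K) (Set.ext fun v => ?_)).mpr h
    have hn' : ¬ n = 0 := by omega
    rw [Set.mem_ofPred_eq, Set.mem_ofPred_eq, mem_hier (acc_false _)]
    simp only [step, Nat.unpair_pair, hn', false_and, false_or, ne_eq, not_false_eq_true,
      true_and, lex, Set.mem_iUnion]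
    refine exists_congr fun w => ?_
    constructor
    · rintro ⟨s, hs, ⟨h0, h1⟩, hsA⟩
      have : pair (pair 0 s.unpair.1.unpair.2) s.unpair.2 = s := by
        rw [← h0, Nat.pair_unpair, Nat.pair_unpair]
      exact ⟨s.unpair.2, ⟨_, h1⟩, by rw [this, hs], by rwa [this]⟩
    · rintro ⟨z, c, hs, hz⟩
      exact ⟨_, hs, by simp, hz⟩

theorem isIdeal_D (K : Struct) : IsIdeal K.D where
  nonempty := ⟨_, mem_D_of_primrecPred (p := fun x => x = x)
    (Primrec.eq.comp Primrec.id Primrec.id)⟩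
  join_mem A hA B hB := by
    have h₁ := fun c => mem_D_of_primrecPred (K := K) (p := fun x => x.unpair.1 = c)
      (Primrec.eq.comp (by fun_prop) (by fun_prop))
    have h₂ := preimage_mem_D hA (f := fun x => x.unpair.2) (by fun_prop)
    have h₃ := preimage_mem_D hB (f := fun x => x.unpair.2) (by fun_prop)
    exact Set.Definable.union (Set.Definable.inter (h₁ 0) h₂) (Set.Definable.inter (h₁ 1) h₃)
  mem_of_redTo A hA B hB := by
    obtain ⟨n, hn⟩ := hB
    convert row_mem_D hA n using 1
    ext x
    simpa using hn () x

theorem defines_iff {n : ℕ} {S : Set (Fin n → ℕ)} : K.Defines S ↔ codes S ∈ K.D := by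
  have henc : DefFun K fun v : Fin n → ℕ => tupleCode v := defFun_of_primrec primrec_tupleCode
  constructor
  · intro h
    have hS : Def K {w : Fin 1 ⊕ Fin n → ℕ | w ∘ Sum.inr ∈ S} :=
      Set.Definable.preimage_comp Sum.inr h
    have hE : Def K {w : Fin 1 ⊕ Fin n → ℕ | tupleCode (fun i => w (.inr i)) = w (.inl 0)} :=
      DefFun.eq (henc.map fun i => defFun_var _) (defFun_var _)
    exact (congrArg (Def K) (Set.ext fun v => Iff.rfl)).mpr
      (Set.Definable.exists_of_finite (hS.inter hE))
  · intro h
    exact (congrArg (Def K) (Set.ext fun v => tupleCode_mem_codes.symm)).mpr (preimage_def h henc)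

theorem code_mem_D {s : Symb} (hs : s ∈ K.symbols) : s.code ∈ K.D := by
  cases s with
  | pred n hn A => exact defines_iff.1 (def_of_mem hs)
  | func n f =>
    refine defines_iff.1 (DefFun.eq ?_ (defFun_var 0))
    exact (defFun_of_mem hs).map fun i => defFun_var _

end Ideal

/-! ### The ideal generated by the symbols -/

section Generated

open FirstOrder FirstOrder.Language

/-- The predicate `p` is arithmetical in some member of `D`. -/
def ArithInIdeal {α : Type} [Primcodable α] (D : Set (Set ℕ)) (p : α → Prop) : Prop :=
  ∃ A ∈ D, ArithIn A p

variable {D : Set (Set ℕ)} {α β : Type} [Primcodable α] [Primcodable β] {p q : α → Prop}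

namespace ArithInIdeal

theorem of_arith (hD : IsIdeal D) (h : ∀ A, ArithIn A p) : ArithInIdeal D p :=
  hD.nonempty.imp fun A hA => ⟨hA, h A⟩

theorem and (hD : IsIdeal D) (hp : ArithInIdeal D p) (hq : ArithInIdeal D q) :
    ArithInIdeal D fun a => p a ∧ q a := by
  obtain ⟨A, hA, hp⟩ := hp
  obtain ⟨B, hB, hq⟩ := hq
  obtain ⟨C, hC, hAC, hBC⟩ := hD.exists_oracle₂ hA hB
  exact ⟨C, hC, .and (hp.of_redTo hAC) (hq.of_redTo hBC)⟩

theorem imp (hD : IsIdeal D) (hp : ArithInIdeal D p) (hq : ArithInIdeal D q) :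
    ArithInIdeal D fun a => p a → q a := by
  obtain ⟨A, hA, hp⟩ := hp
  obtain ⟨B, hB, hq⟩ := hq
  obtain ⟨C, hC, hAC, hBC⟩ := hD.exists_oracle₂ hA hB
  exact ⟨C, hC, .imp (hp.of_redTo hAC) (hq.of_redTo hBC)⟩

theorem ex {p : α → β → Prop} (hp : ArithInIdeal D fun a : α × β => p a.1 a.2) :
    ArithInIdeal D fun a => ∃ b, p a b := by
  obtain ⟨A, hA, hp⟩ := hp
  exact ⟨A, hA, .ex hp⟩

theorem all {p : α → β → Prop} (hp : ArithInIdeal D fun a : α × β => p a.1 a.2) :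
    ArithInIdeal D fun a => ∀ b, p a b := by
  obtain ⟨A, hA, hp⟩ := hp
  exact ⟨A, hA, .all hp⟩

theorem comp {p : β → Prop} (hp : ArithInIdeal D p) {f : α → β} (hf : Primrec f) :
    ArithInIdeal D fun a => p (f a) := by
  obtain ⟨A, hA, hp⟩ := hp
  exact ⟨A, hA, hp.comp hf⟩

theorem forall_fin (hD : IsIdeal D) {n : ℕ} {p : Fin n → α → Prop}
    (hp : ∀ i, ArithInIdeal D (p i)) : ArithInIdeal D fun a => ∀ i, p i a := by
  induction n with
  | zero =>
    exact of_arith hD fun A => (Arith.eq (f := fun a : α => a) (g := fun a => a) (by fun_prop)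
      (by fun_prop)).of_iff fun _ a => by simp
  | succ n ih =>
    obtain ⟨A, hA, h⟩ := and hD (hp 0) (ih (p := fun i => p i.succ) fun i => hp i.succ)
    exact ⟨A, hA, h.of_iff fun _ a => Fin.forall_fin_succ⟩

theorem mem_codes {n : ℕ} {S : Set (Fin n → ℕ)} (hS : codes S ∈ D) {f : α → Fin n → ℕ}
    (hf : Primrec f) : ArithInIdeal D fun a => f a ∈ S :=
  ⟨_, hS, (Arith.mem (f := fun a => tupleCode (f a)) (primrec_tupleCode.comp hf)).of_iff
    fun _ a => by simp⟩

end ArithInIdeal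

theorem primrec_of_forall {n : ℕ} {f : α → Fin n → ℕ} (hf : ∀ i, Primrec fun a => f a i) :
    Primrec f :=
  Primrec.fin_curry.2 (Primrec₂.swap (Primrec.fin_curry₁.2 hf))

theorem primrec_apply {n : ℕ} {f : α → Fin n → ℕ} (hf : Primrec f) (i : Fin n) :
    Primrec fun a => f a i :=
  Primrec.fin_app.comp hf (Primrec.const i)

variable {K : Struct}

theorem arithInIdeal_term (hD : IsIdeal D) (hK : ∀ s ∈ K.symbols, s.code ∈ D) {γ : Type}
    (t : K.lang.Term γ) {env : α → γ → ℕ} (henv : ∀ i, Primrec fun a => env a i) :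
    ArithInIdeal D fun a : α × ℕ => t.realize (env a.1) = a.2 := by
  induction t with
  | var i =>
    refine ArithInIdeal.of_arith hD fun A => Arith.eq (f := fun a : α × ℕ => env a.1 i) ?_
      (by fun_prop)
    exact (henv i).comp Primrec.fst
  | @func n f ts ih =>
    have h₁ : ArithInIdeal D fun a : (α × ℕ) × (Fin n → ℕ) => f.1 a.2 = a.1.2 := by
      refine (ArithInIdeal.mem_codes (hK _ f.2) (f := fun a : (α × ℕ) × (Fin n → ℕ) =>
        (Fin.cons a.1.2 a.2 : Fin (n + 1) → ℕ)) (primrec_of_forall fun i => ?_))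
      refine Fin.cases ?_ (fun i => ?_) i
      · simp only [Fin.cons_zero]
        fun_prop
      · simp only [Fin.cons_succ]
        exact primrec_apply (by fun_prop) i
    have h₂ : ArithInIdeal D fun a : (α × ℕ) × (Fin n → ℕ) =>
        ∀ i, (ts i).realize (env a.1.1) = a.2 i :=
      ArithInIdeal.forall_fin hD fun i => (ih i).comp
        (f := fun a : (α × ℕ) × (Fin n → ℕ) => (a.1.1, a.2 i))
        (primrec_mk (by fun_prop) (primrec_apply (by fun_prop) i))
    obtain ⟨A, hA, h⟩ := ArithInIdeal.ex (p := fun (a : α × ℕ) (u : Fin n → ℕ) =>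
      f.1 u = a.2 ∧ ∀ i, (ts i).realize (env a.1) = u i) (h₁.and hD h₂)
    refine ⟨A, hA, h.of_iff fun _ a => ?_⟩
    constructor
    · exact fun h => ⟨fun i => (ts i).realize (env a.1), h, fun i => rfl⟩
    · rintro ⟨u, hu, h⟩
      obtain rfl : (fun i => (ts i).realize (env a.1)) = u := funext h
      exact hu

theorem arithInIdeal_formula (hD : IsIdeal D) (hK : ∀ s ∈ K.symbols, s.code ∈ D) {γ : Type}
    {k : ℕ} (φ : K.lang.BoundedFormula γ k) {α : Type} [Primcodable α] {env : α → γ → ℕ}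
    {xs : α → Fin k → ℕ} (henv : ∀ i, Primrec fun a => env a i)
    (hxs : ∀ i, Primrec fun a => xs a i) :
    ArithInIdeal D fun a => φ.Realize (env a) (xs a) := by
  have hsum : ∀ {k : ℕ} {α : Type} [Primcodable α] {env : α → γ → ℕ} {xs : α → Fin k → ℕ},
      (∀ i, Primrec fun a => env a i) → (∀ i, Primrec fun a => xs a i) →
      ∀ i, Primrec fun a => Sum.elim (env a) (xs a) i := by
    intro k α _ env xs henv hxs i
    cases i with
    | inl i => exact henv i
    | inr i => exact hxs i
  induction φ generalizing α with
  | falsum =>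
    exact ArithInIdeal.of_arith hD fun A => (Arith.eq (f := fun a : α => a) (g := fun a => a)
      (by fun_prop) (by fun_prop)).not.of_iff fun _ a => by simp [BoundedFormula.Realize]
  | equal t₁ t₂ =>
    obtain ⟨A, hA, h⟩ := ArithInIdeal.ex (p := fun (a : α) (y : ℕ) =>
      t₁.realize (Sum.elim (env a) (xs a)) = y ∧ t₂.realize (Sum.elim (env a) (xs a)) = y)
      ((arithInIdeal_term hD hK t₁ (hsum henv hxs)).and hD
        (arithInIdeal_term hD hK t₂ (hsum henv hxs)))
    exact ⟨A, hA, h.of_iff fun _ a => by simp [BoundedFormula.Realize, eq_comm]⟩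
  | @rel k n R ts =>
    obtain ⟨hn, hR⟩ := R.2
    have h₁ : ArithInIdeal D fun a : α × (Fin n → ℕ) => a.2 ∈ R.1 :=
      ArithInIdeal.mem_codes (hK _ hR) (by fun_prop)
    have h₂ : ArithInIdeal D fun a : α × (Fin n → ℕ) =>
        ∀ i, (ts i).realize (Sum.elim (env a.1) (xs a.1)) = a.2 i :=
      ArithInIdeal.forall_fin hD fun i => (arithInIdeal_term hD hK (ts i) (hsum henv hxs)).comp
        (f := fun a : α × (Fin n → ℕ) => (a.1, a.2 i))
        (primrec_mk (by fun_prop) (primrec_apply (by fun_prop) i))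
    obtain ⟨A, hA, h⟩ := ArithInIdeal.ex (p := fun (a : α) (u : Fin n → ℕ) =>
      u ∈ R.1 ∧ ∀ i, (ts i).realize (Sum.elim (env a) (xs a)) = u i) (h₁.and hD h₂)
    refine ⟨A, hA, h.of_iff fun _ a => ?_⟩
    constructor
    · exact fun h => ⟨fun i => (ts i).realize (Sum.elim (env a) (xs a)), h, fun i => rfl⟩
    · rintro ⟨u, hu, h⟩
      obtain rfl : (fun i => (ts i).realize (Sum.elim (env a) (xs a))) = u := funext h
      exact hu
  | imp φ₁ φ₂ ih₁ ih₂ => exact (ih₁ henv hxs).imp hD (ih₂ henv hxs)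
  | @all k φ ih =>
    refine ArithInIdeal.all (p := fun (a : α) (x : ℕ) => φ.Realize (env a) (Fin.snoc (xs a) x)) ?_
    refine ih (env := fun a : α × ℕ => env a.1) (xs := fun a : α × ℕ => Fin.snoc (xs a.1) a.2)
      (fun i => (henv i).comp Primrec.fst) fun i => ?_
    refine Fin.lastCases ?_ (fun i => ?_) i
    · simp only [Fin.snoc_last]
      fun_prop
    · simp only [Fin.snoc_castSucc]
      exact (hxs i).comp Primrec.fst

/-- The family `K.D` is the least arithmetical ideal that contains the codes of the symbols. -/
theorem D_subset_of_codes (hD : IsIdeal D) (hK : ∀ s ∈ K.symbols, s.code ∈ D) : K.D ⊆ D := by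
  intro X hX
  obtain ⟨φ, hφ⟩ := (Set.empty_definable_iff).1 hX
  obtain ⟨A, hA, h⟩ := arithInIdeal_formula hD hK φ (α := ℕ) (env := fun x _ => x)
    (xs := fun _ => (default : Fin 0 → ℕ)) (fun _ => by fun_prop) (fun i => i.elim0)
  refine hD.mem_of_arithIn hA (h.of_iff fun _ x => ?_)
  have := Set.ext_iff.1 hφ fun _ => x
  simp only [Set.mem_ofPred_eq, Formula.Realize] at this
  rw [this]
  exact iff_of_eq (congrArg _ (Subsingleton.elim _ _))

end Generated

/-! ### Universal predicates as covers of ideals -/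

section Predicates

variable {K : Struct} {P : Set (Fin 2 → ℕ)}

/-- The set of the codes of the pairs in a binary predicate; its rows are the sections of the
predicate. -/
def pairCodes (P : Set (Fin 2 → ℕ)) : Set ℕ := {t | ![t.unpair.1, t.unpair.2] ∈ P}

theorem row_pairCodes : row (pairCodes P) = sect P := by
  ext n x
  simp [pairCodes, sect]

theorem exists_pairCodes (X : Set ℕ) : ∃ P, pairCodes P = X :=
  ⟨{v | pair (v 0) (v 1) ∈ X}, by ext; simp [pairCodes]⟩

theorem isUniversal_iff : IsUniversal K P ↔ Covers K.D (pairCodes P) := by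
  rw [Covers, row_pairCodes]
  exact forall₂_congr fun _ _ => exists_congr fun _ => eq_comm

theorem isProperUniversal_iff : IsProperUniversal K P ↔ Enumerates K.D (pairCodes P) := by
  rw [Enumerates, row_pairCodes, IsProperUniversal]

theorem pairCodes_redTo_codes : RedTo (pairCodes P) (codes P) := by
  refine (Arith.mem (f := fun t : ℕ => tupleCode ![t.unpair.1, t.unpair.2]) ?_).of_iff
    fun _ t => by simp [pairCodes]
  refine primrec_tupleCode.comp (primrec_of_forall fun i => ?_)
  fin_cases i
  · exact Primrec.fst.comp Primrec.unpair
  · exact Primrec.snd.comp Primrec.unpair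

theorem codes_redTo_pairCodes : RedTo (codes P) (pairCodes P) := by
  have h₁ : ArithIn (pairCodes P) fun a : ℕ × (Fin 2 → ℕ) => pair (a.2 0) (a.2 1) ∈ pairCodes P :=
    Arith.mem (f := fun a : ℕ × (Fin 2 → ℕ) => pair (a.2 0) (a.2 1))
      (primrec_pair (primrec_apply Primrec.snd 0) (primrec_apply Primrec.snd 1))
  have h₂ : ArithIn (pairCodes P) fun a : ℕ × (Fin 2 → ℕ) => tupleCode a.2 = a.1 :=
    Arith.eq (primrec_tupleCode.comp Primrec.snd) Primrec.fst
  refine (Arith.ex (Ψ := fun _ (m : ℕ) (v : Fin 2 → ℕ) =>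
    pair (v 0) (v 1) ∈ pairCodes P ∧ tupleCode v = m) (h₁.and h₂)).of_iff fun _ m => ?_
  refine exists_congr fun v => and_congr_left fun _ => ?_
  have hv : ![v 0, v 1] = v := by
    ext i
    fin_cases i <;> rfl
  simp [pairCodes, hv]

theorem defines_iff_pairCodes : K.Defines P ↔ pairCodes P ∈ K.D := by
  rw [defines_iff]
  exact ⟨fun h => (isIdeal_D K).mem_of_redTo _ h _ pairCodes_redTo_codes,
    fun h => (isIdeal_D K).mem_of_redTo _ h _ codes_redTo_pairCodes⟩

theorem D_mono {K' : Struct} (h : K.symbols ⊆ K'.symbols) : K.D ⊆ K'.D :=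
  D_subset_of_codes (isIdeal_D K') fun _ hs => code_mem_D (h hs)

theorem D_add_eq_below (h : Covers K.D (pairCodes P)) :
    (K.add P).D = below (pairCodes P) := by
  refine (D_subset_of_codes (isIdeal_below _) ?_).antisymm fun A hA =>
    (isIdeal_D _).mem_of_redTo _ (defines_iff_pairCodes.1 (def_of_mem (hn := two_pos) ?_)) _ hA
  · rintro s (hs | rfl)
    · exact h.redTo (code_mem_D hs)
    · exact codes_redTo_pairCodes
  · exact Or.inr rfl

theorem isCanonicUniversal_iff : IsCanonicUniversal K P ↔
    Covers K.D (pairCodes P) ∧ ∀ X, Covers K.D X → RedTo (pairCodes P) X := by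
  rw [IsCanonicUniversal, IsCanonic, isUniversal_iff]
  refine and_congr_right fun _ => ⟨fun h X hX => ?_, fun h Q hQ => ?_⟩
  · obtain ⟨Q, rfl⟩ := exists_pairCodes X
    have := defines_iff_pairCodes.1 (h Q (isUniversal_iff.2 hX))
    rwa [D_add_eq_below hX] at this
  · rw [isUniversal_iff] at hQ
    rw [defines_iff_pairCodes, D_add_eq_below hQ]
    exact h _ hQ

theorem isCanonicProperUniversal_iff : IsCanonicProperUniversal K P ↔
    Enumerates K.D (pairCodes P) ∧ ∀ X, Enumerates K.D X → RedTo (pairCodes P) X := by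
  rw [IsCanonicProperUniversal, IsCanonic, isProperUniversal_iff]
  refine and_congr_right fun _ => ⟨fun h X hX => ?_, fun h Q hQ => ?_⟩
  · obtain ⟨Q, rfl⟩ := exists_pairCodes X
    have := defines_iff_pairCodes.1 (h Q (isProperUniversal_iff.2 hX))
    rwa [D_add_eq_below hX.covers] at this
  · rw [isProperUniversal_iff] at hQ
    rw [defines_iff_pairCodes, D_add_eq_below hQ.covers]
    exact h _ hQ

theorem exists_D_eq_below (hK : K.LFinite) : ∃ B, K.D = below B := by
  obtain ⟨B, hB, h⟩ : ∃ B ∈ K.D, ∀ s ∈ K.symbols, RedTo s.code B := by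
    refine Set.Finite.induction_on_subset (motive := fun F _ =>
      ∃ B ∈ K.D, ∀ s ∈ F, RedTo s.code B) _ hK ?_ ?_
    · obtain ⟨B, hB⟩ := (isIdeal_D K).nonempty
      exact ⟨B, hB, by simp⟩
    · rintro s F hs - - ⟨B, hB, h⟩
      refine ⟨_, (isIdeal_D K).join_mem _ (code_mem_D hs) _ hB, ?_⟩
      rintro s' (rfl | hs')
      · exact redTo_join_left _ _
      · exact (h s' hs').trans (redTo_join_right _ _)
  exact ⟨B, (D_subset_of_codes (isIdeal_below B) h).antisymm
    fun A hA => (isIdeal_D K).mem_of_redTo _ hB _ hA⟩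

end Predicates

/-! ### Hierarchies of structures as towers of ideals -/

namespace IsSequence

variable {C : Struct → Set (Fin 2 → ℕ) → Prop} {N : Struct} {ξ : Ordinal.{0}}
  {M : Ordinal.{0} → Struct}

theorem symbols_mono (h : IsSequence C N ξ M) {α β : Ordinal} (hαβ : α ≤ β) (hβ : β ≤ ξ) :
    (M α).symbols ⊆ (M β).symbols := by
  induction β using Ordinal.limitRecOn generalizing α with
  | zero => rw [nonpos_iff_eq_zero.1 hαβ]
  | add_one β ih =>
    rw [← Order.succ_eq_add_one] at hαβ hβ ⊢
    rcases hαβ.eq_or_lt with rfl | hαβ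
    · rfl
    · have hlt : β < ξ := (Order.lt_succ β).trans_le hβ
      obtain ⟨P, -, hP⟩ := h.succ β hlt
      rw [hP]
      exact (ih (Order.lt_succ_iff.1 hαβ) hlt.le).trans Set.subset_union_left
  | limit β hlim ih =>
    rcases hαβ.eq_or_lt with rfl | hαβ
    · rfl
    · rw [h.limit β hβ hlim]
      exact Set.subset_biUnion_of_mem (u := fun α => (M α).symbols)
        (show α ∈ {α | α < β} from hαβ)

theorem D_limit (h : IsSequence C N ξ M) {β : Ordinal} (hβ : β ≤ ξ)
    (hlim : Order.IsSuccLimit β) : (M β).D = ⋃ α < β, (M α).D := by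
  have hmono : ∀ {α α'}, α ≤ α' → α' < β → (M α).D ⊆ (M α').D := fun hle hlt =>
    D_mono (h.symbols_mono hle (hlt.le.trans hβ))
  have hD : IsIdeal (⋃ α < β, (M α).D) := by
    refine ⟨?_, fun A hA A' hA' => ?_, fun A hA A' hA' => ?_⟩
    · obtain ⟨A, hA⟩ := (isIdeal_D (M 0)).nonempty
      exact ⟨A, Set.mem_iUnion₂.2 ⟨0, by simpa using hlim.bot_lt, hA⟩⟩
    · obtain ⟨α, hα, hA⟩ := Set.mem_iUnion₂.1 hA
      obtain ⟨α', hα', hA'⟩ := Set.mem_iUnion₂.1 hA'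
      have hlt : max α α' < β := max_lt hα hα'
      exact Set.mem_iUnion₂.2 ⟨_, hlt, (isIdeal_D _).join_mem _ (hmono (le_max_left _ _) hlt hA) _
        (hmono (le_max_right _ _) hlt hA')⟩
    · obtain ⟨α, hα, hA⟩ := Set.mem_iUnion₂.1 hA
      exact Set.mem_iUnion₂.2 ⟨α, hα, (isIdeal_D _).mem_of_redTo A hA A' hA'⟩
  refine (D_subset_of_codes hD fun s hs => ?_).antisymm
    (Set.iUnion₂_subset fun α hα => D_mono (h.symbols_mono hα.le hβ))
  rw [h.limit β hβ hlim] at hs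
  obtain ⟨α, hα, hs⟩ := Set.mem_iUnion₂.1 hs
  exact Set.mem_iUnion₂.2 ⟨α, hα, code_mem_D hs⟩

/-- A sequence of structures that adds canonic universal predicates gives a tower of ideals. -/
theorem exists_isTower (h : IsSequence IsCanonicUniversal N ξ M) (hN : N.LFinite) :
    ∃ B P, IsTower ξ B (fun α => (M α).D) P := by
  obtain ⟨B, hB⟩ := exists_D_eq_below hN
  choose! P hP hM using h.succ
  refine ⟨B, fun α => pairCodes (P α), ?_, fun α hα => ?_, fun α hα => ?_, fun α hα => ?_,
    fun β hβ hlim => h.D_limit hβ hlim⟩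
  · rw [h.zero, hB]
  · rw [hM α hα, D_add_eq_below (isCanonicUniversal_iff.1 (hP α hα)).1]
  · exact (isCanonicUniversal_iff.1 (hP α hα)).1
  · exact (isCanonicUniversal_iff.1 (hP α hα)).2

/-- A sequence of structures can be extended by a suitable predicate. -/
theorem extend (h : IsSequence C N ξ M) {P : Set (Fin 2 → ℕ)} (hP : C (M ξ) P) :
    ∃ M', IsSequence C N (Order.succ ξ) M' := by
  classical
  refine ⟨fun α => if α ≤ ξ then M α else (M ξ).add P, ?_, fun α hα => ?_, fun β hβ hlim => ?_⟩
  · simpa using h.zero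
  · have hle := Order.lt_succ_iff.1 hα
    rcases hle.eq_or_lt with rfl | hlt
    · exact ⟨P, by simpa using hP, by simp⟩
    · obtain ⟨Q, hQ, hM⟩ := h.succ α hlt
      exact ⟨Q, by simpa [hle] using hQ, by simpa [hle, hlt] using hM⟩
  · have hβ : β ≤ ξ := by
      rcases hβ.eq_or_lt with rfl | hlt
      · exact absurd hlim (Order.not_isSuccLimit_succ ξ)
      · exact Order.lt_succ_iff.1 hlt
    rw [if_pos hβ, h.limit β hβ hlim]
    exact Set.iUnion₂_congr fun α hα => by rw [if_pos (hα.le.trans hβ)]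

/-- Both hierarchies over an `L`-finite structure have the same definable sets, as long as both are
defined: the canonic proper universal predicates are least enumerations, and below the top of the
first hierarchy these are also the least covers. -/
theorem D_eq {ζ : Ordinal.{0}} {M' : Ordinal.{0} → Struct}
    (h : IsSequence IsCanonicUniversal N ξ M) (h' : IsSequence IsCanonicProperUniversal N ζ M')
    (hN : N.LFinite) {α : Ordinal} (hα : α ≤ ξ) (hα' : α ≤ ζ) : (M' α).D = (M α).D := by
  obtain ⟨B, P, T⟩ := h.exists_isTower hN
  induction α using Ordinal.limitRecOn with
  | zero => rw [h.zero, h'.zero]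
  | add_one α ih =>
    rw [← Order.succ_eq_add_one] at hα hα' ⊢
    have hlt := (Order.lt_succ α).trans_le hα
    have hlt' := (Order.lt_succ α).trans_le hα'
    obtain ⟨R, hR, hM'⟩ := h'.succ α hlt'
    rw [isCanonicProperUniversal_iff, ih hlt.le hlt'.le] at hR
    obtain ⟨Q, hQ, hQle, hQle'⟩ := T.exists_least_enumeration hlt.le
    have hcov : Covers (M' α).D (pairCodes R) := by
      rw [ih hlt.le hlt'.le]
      exact hR.1.covers
    rw [hM', D_add_eq_below hcov, T.succ α hlt]
    have h₁ : RedTo (pairCodes R) (P α) :=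
      (hR.2 Q hQ).trans (hQle' hlt _ (T.covers α hlt))
    have h₂ : RedTo (P α) (pairCodes R) := T.least α hlt _ hR.1.covers
    exact Set.ext fun A => ⟨fun hA => RedTo.trans hA h₁, fun hA => RedTo.trans hA h₂⟩
  | limit β hlim ih =>
    rw [h.D_limit hα hlim, h'.D_limit hα' hlim]
    exact Set.iUnion₂_congr fun γ hγ => ih γ hγ (hγ.le.trans hα) (hγ.le.trans hα')

end IsSequence

theorem IsMaximalSequence.not_exists {C : Struct → Set (Fin 2 → ℕ) → Prop} {N : Struct}
    {ξ : Ordinal.{0}} {M : Ordinal.{0} → Struct} (h : IsMaximalSequence C N ξ M) :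
    ¬ ∃ P, C (M ξ) P := by
  rintro ⟨P, hP⟩
  exact (h.2.2 (h.1.extend hP)).not_gt (Order.lt_succ ξ)

end TarskiHierarchy

theorem theorem2 (N : TarskiHierarchy.Struct) (hN : N.LFinite)
    (lam lamp : Ordinal.{0}) (M Mp : Ordinal.{0} → TarskiHierarchy.Struct)
    (hM : TarskiHierarchy.IsTarskiHierarchy N lam M)
    (hMp : TarskiHierarchy.IsProperTarskiHierarchy N lamp Mp) :
    lam < lamp ∧
    (∀ α ≤ lam, (Mp α).Equivalent (M α)) ∧
    (¬ ∃ P, TarskiHierarchy.IsCanonicUniversal (M lam) P) ∧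
    (∃ P, TarskiHierarchy.IsCanonicProperUniversal (M lam) P) := by
  obtain ⟨B, P, T⟩ := hM.1.exists_isTower hN
  have hleast : ∀ α ≤ lam, ∀ K : TarskiHierarchy.Struct, K.D = (M α).D →
      ∃ P, TarskiHierarchy.IsCanonicProperUniversal K P := by
    intro α hα K hK
    obtain ⟨Q, hQ, hQle, -⟩ := T.exists_least_enumeration hα
    obtain ⟨R, rfl⟩ := TarskiHierarchy.exists_pairCodes Q
    refine ⟨R, ?_⟩
    rw [TarskiHierarchy.isCanonicProperUniversal_iff, hK]
    exact ⟨hQ, hQle⟩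
  -- Otherwise the proper hierarchy could be continued beyond `lamp`.
  have hlt : lam < lamp := by
    by_contra! hle
    exact hMp.not_exists (hleast lamp hle _ (hM.1.D_eq hMp.1 hN hle le_rfl))
  exact ⟨hlt, fun α hα => hM.1.D_eq hMp.1 hN hα (hα.trans hlt.le), hM.not_exists,
    hleast lam le_rfl _ rfl⟩
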